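/- Let $m\ge 1$, let $\mathcal X\subset\mathbb R^d$ be nonempty, closed and convex, let $\xi=(\xi_0,\dots,\xi_m)$ be a random vector with values in $\Xi_0\times\dots\times\Xi_m$, and let $F_i:\mathcal X\times\Xi_i\to\mathbb R$ ($0\le i\le m$) be continuous and convex in $x$ for each value of $\xi_i$, with finite expectations $f_i(x)=\mathbb E[F_i(x,\xi_i)]$. Given $r_1,\dots,r_m\in\mathbb R$, put $f^*=\min\{f_0(x): x\in\mathcal X,\ f_i(x)\le r_i,\ i=1,\dots,m\}$ and assume that some $\tilde x\in\mathcal X$ satisfies $f_i(\tilde x)<r_i$ for $i=1,\dots,m$ and $f_0(\tilde x)>f^*$. For $r>f^*$ put $r_0=r$, $\mathcal P(r,x)=\max_{0\le i\le m}(f_i(x)-r_i)$, $H(r)=\min_{x\in\mathcal X}\mathcal P(r,x)$, $\mathcal Y=\{y\in\mathbb R^{m+1}: y\ge 0,\ \sum_i y_i=1\}$, $\phi(x,y)=\mathbb E\big[\sum_i y_i(F_i(x,\xi_i)-r_i)\big]$, $U(x)=\max_{y\in\mathcal Y}\phi(x,y)$ and $L(y)=\min_{x\in\mathcal X}\phi(x,y)$.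 Let $\omega_x:\mathcal X\to\mathbb R$ and $\omega_y:\mathcal Y\to\mathbb R$ be distance-generating functions with moduli $\alpha_x,\alpha_y>0$ with respect to norms $\|\cdot\|_x$, $\|\cdot\|_y$ (continuous, strongly convex with these moduli, and continuously differentiable on the sets $\mathcal X^o$, $\mathcal Y^o$ of points at which they have a subgradient), with $\omega_x$ bounded above on $\mathcal X$. Put $D_x^2=\max_{\mathcal X}\omega_x-\min_{\mathcal X}\omega_x$, $D_y^2=\max_{\mathcal Y}\omega_y-\min_{\mathcal Y}\omega_y$ (with $D_x,D_y\ge 0$), $\mathcal Z=\mathcal X\times\mathcal Y$, $\omega_z(x,y)=\frac{\omega_x(x)}{2D_x^2}+\frac{\omega_y(y)}{2D_y^2}$ and $V(z',z)=\omega_z(z)-\omega_z(z')-\nabla\omega_z(z')^\top(z-z')$. Let $F_i'(x,\xi_i)\in\partial F_i(x,\xi_i)$ be measurable selections of subgradients with respect to $x$, let $G_x(x,y,\xi)=\sum_i y_iF_i'(x,\xi_i)$, $G_y(x,y,\xi)=(F_i(x,\xi_i)-r_i)_{i=0}^m$ and $G=(G_x,-G_y)$, and assume that there are $M_x,M_y>0$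 such that, for all $x\in\mathcal X$ and $y\in\mathcal Y$, $$\mathbb E\big[\exp(\|G_x(x,y,\xi)\|_{*,x}^2/M_x^2)\big]\le e,\qquad \mathbb E\big[\exp(\|G_y(x,y,\xi)\|_{*,y}^2/M_y^2)\big]\le e,$$ where $\|\cdot\|_{*,x}$, $\|\cdot\|_{*,y}$ are the dual norms. Put $M=\sqrt{\tfrac{2D_x^2}{\alpha_x}M_x^2+\tfrac{2D_y^2}{\alpha_y}M_y^2}$ and $\gamma_t=\frac1{M\sqrt{t+1}}$. Stochastic mirror descent (SMD) starts at $z^{(0)}\in\arg\min_{\mathcal Z}\omega_z$, draws i.i.d. copies $\xi^{(t)}$ of $\xi$, and sets $z^{(t+1)}=\arg\min_{z\in\mathcal Z}\{\gamma_tG(z^{(t)},\xi^{(t)})^\top(z-z^{(t)})+V(z^{(t)},z)\}$ and $(\bar x^{(t)},\bar y^{(t)})=\sum_{s=0}^t\gamma_sz^{(s)}\big/\sum_{s=0}^t\gamma_s$. Let $\epsilon_{\mathcal A}>0$, $\delta\in(0,1)$, $\Omega(\delta)=\max\big\{\sqrt{12\ln(24/\delta)},\tfrac43\ln(24/\delta)\big\}$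 and $$W(\delta,\epsilon_{\mathcal A})=\max\left\{6,\left(\frac{8(10M\Omega(\delta)+4.5M)}{\epsilon_{\mathcal A}}\ln\left(\frac{4(10M\Omega(\delta)+4.5M)}{\epsilon_{\mathcal A}}\right)\right)^2-2\right\}.$$ Then, for every integer $t\ge\lfloor W(\delta,\epsilon_{\mathcal A})\rfloor$, $U(\bar x^{(t)})-L(\bar y^{(t)})\le\epsilon_{\mathcal A}$ with probability at least $1-\delta$; in particular this bound is reached in at most $W(\delta,\epsilon_{\mathcal A})$ iterations. As a consequence, SMD with any iteration limit $N\ge W(\delta,\epsilon_{\mathcal A})$ is a valid stochastic oracle: it returns $\hat x=\bar x^{(N)}\in\mathcal X$ and the value $\hat U=U(\bar x^{(N)})$ such that, with probability at least $1-\delta$, both $\mathcal P(r,\hat x)-H(r)\le\epsilon_{\mathcal A}$ and $|\hat U-H(r)|\le\epsilon_{\mathcal A}$. -/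

import Mathlib

open MeasureTheory ProbabilityTheory

noncomputable section

namespace SMD

/-! ## Norms, subgradients, distance-generating functions -/

/-- The dual norm `max {⟨ζ, v⟩ : p v ≤ 1}` of a norm `p` on `ℝⁿ`. -/
def dualNorm {n : ℕ} (p : Seminorm ℝ (Fin n → ℝ)) (ζ : Fin n → ℝ) : ℝ :=
  sSup {c : ℝ | ∃ v : Fin n → ℝ, p v ≤ 1 ∧ c = ζ ⬝ᵥ v}

/-- The subdifferential at `x` of a function `h : K → ℝ` (values of `h` off `K` are ignored). -/
def subdifferentialOn {n : ℕ} (K : Set (Fin n → ℝ)) (h : (Fin n → ℝ) → ℝ) (x : Fin n → ℝ) :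
    Set (Fin n → ℝ) :=
  {g | ∀ u ∈ K, h x + g ⬝ᵥ (u - x) ≤ h u}

/-- The set `K°` of the points of `K` at which `ω : K → ℝ` has a subgradient. -/
def subdiffDomain {n : ℕ} (K : Set (Fin n → ℝ)) (ω : (Fin n → ℝ) → ℝ) : Set (Fin n → ℝ) :=
  {x ∈ K | (subdifferentialOn K ω x).Nonempty}

/-- `ω : K → ℝ` is a distance-generating function of modulus `α` with respect to the norm `p`:
continuous and `α`-strongly convex on `K`, and continuously differentiable on `K°`, with
derivative `dω`. (As `K` may have empty interior, the derivative is taken within `K`; its values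
along the directions `u - x`, `u ∈ K`, are determined by `ω`, and no others are ever used.) -/
structure IsDistanceGenerating {n : ℕ} (K : Set (Fin n → ℝ)) (p : Seminorm ℝ (Fin n → ℝ)) (α : ℝ)
    (ω : (Fin n → ℝ) → ℝ) (dω : (Fin n → ℝ) → ((Fin n → ℝ) →L[ℝ] ℝ)) : Prop where
  modulus_pos : 0 < α
  continuousOn : ContinuousOn ω K
  stronglyConvex : ∀ u ∈ K, ∀ v ∈ K, ∀ a b : ℝ, 0 ≤ a → 0 ≤ b → a + b = 1 →
    ω (a • u + b • v) ≤ a * ω u + b * ω v - α / 2 * (a * b) * p (u - v) ^ 2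
  hasDerivative : ∀ x ∈ subdiffDomain K ω, HasFDerivWithinAt ω (dω x) K x
  continuousOn_derivative : ContinuousOn dω (subdiffDomain K ω)

/-- The diameter `√(max_K ω - min_K ω)` of `K` with respect to `ω`. -/
def diameter {n : ℕ} (K : Set (Fin n → ℝ)) (ω : (Fin n → ℝ) → ℝ) : ℝ :=
  √(sSup (ω '' K) - sInf (ω '' K))

/-- A minimizer of `h` over `K` (an arbitrary point if there is none). -/
def argminOn {E : Type*} [Nonempty E] (K : Set E) (h : E → ℝ) : E :=
  Classical.epsilon fun z => z ∈ K ∧ ∀ w ∈ K, h z ≤ h w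

/-- The event `A` has probability at least `p`. -/
def HoldsWithProbAtLeast {S : Type*} [MeasurableSpace S] (μ : Measure S) (p : ℝ)
    (A : S → Prop) : Prop :=
  ∃ T : Set S, MeasurableSet T ∧ (∀ s ∈ T, A s) ∧ ENNReal.ofReal p ≤ μ T

/-! ## The stochastic problem with expectation constraints -/

/-- The data of `min {f₀(x) : x ∈ X, fᵢ(x) ≤ rᵢ (1 ≤ i ≤ m)}` with `fᵢ(x) = 𝔼[Fᵢ(x, ξᵢ)]`.
`law` is the joint law of `ξ = (ξ₀, …, ξ_m)`; the `Fᵢ` matter on `X × Ξᵢ` only. -/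
structure Problem (d : ℕ) {m : ℕ} (Ξ : Fin (m + 1) → Type*) [∀ i, MeasurableSpace (Ξ i)] where
  X : Set (Fin d → ℝ)
  F : ∀ i, (Fin d → ℝ) → Ξ i → ℝ
  law : Measure (∀ i, Ξ i)
  level : Fin m → ℝ
  nonempty_X : X.Nonempty
  isClosed_X : IsClosed X
  convex_X : Convex ℝ X
  convexOn_F : ∀ i ξ, ConvexOn ℝ X fun x => F i x ξ
  continuousOn_F : ∀ i ξ, ContinuousOn (fun x => F i x ξ) X
  measurable_F : ∀ i, ∀ x ∈ X, Measurable (F i x)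
  isProbabilityMeasure_law : IsProbabilityMeasure law
  integrable_F : ∀ i, ∀ x ∈ X, Integrable (fun ξ : ∀ i, Ξ i => F i x (ξ i)) law

namespace Problem

variable {d m : ℕ} {Ξ : Fin (m + 1) → Type*} [∀ i, MeasurableSpace (Ξ i)]

/-- `fᵢ(x) = 𝔼[Fᵢ(x, ξᵢ)]`. -/
def f (S : Problem d Ξ) (i : Fin (m + 1)) (x : Fin d → ℝ) : ℝ :=
  ∫ ξ, S.F i x (ξ i) ∂S.law

/-- The optimal value `f*`. -/
def fstar (S : Problem d Ξ) : ℝ :=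
  sInf (S.f 0 '' {x ∈ S.X | ∀ i : Fin m, S.f i.succ x ≤ S.level i})

/-- There is a strictly feasible, sub-optimal point. -/
def StrictlyFeasible (S : Problem d Ξ) : Prop :=
  ∃ x ∈ S.X, (∀ i : Fin m, S.f i.succ x - S.level i < 0) ∧ S.fstar < S.f 0 x

/-- The vector `(r₀, r₁, …, r_m)` with `r₀ = r`. -/
def levels (S : Problem d Ξ) (r : ℝ) : Fin (m + 1) → ℝ :=
  Fin.cons r S.level

/-- `𝒫(r, x) = max {f₀(x) - r, f₁(x) - r₁, …, f_m(x) - r_m}`. -/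
def P (S : Problem d Ξ) (r : ℝ) (x : Fin d → ℝ) : ℝ :=
  Finset.univ.sup' Finset.univ_nonempty fun i : Fin (m + 1) => S.f i x - S.levels r i

/-- The level-set function `H(r) = min_{x ∈ X} 𝒫(r, x)`. -/
def H (S : Problem d Ξ) (r : ℝ) : ℝ :=
  sInf (S.P r '' S.X)

/-- The simplex `Y`. -/
def Y (_S : Problem d Ξ) : Set (Fin (m + 1) → ℝ) :=
  stdSimplex ℝ (Fin (m + 1))

/-- `Φ(x, y, ξ) = ∑ᵢ yᵢ (Fᵢ(x, ξᵢ) - rᵢ)`. -/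
def Phi (S : Problem d Ξ) (r : ℝ) (x : Fin d → ℝ) (y : Fin (m + 1) → ℝ) (ξ : ∀ i, Ξ i) : ℝ :=
  ∑ i, y i * (S.F i x (ξ i) - S.levels r i)

/-- `φ(x, y) = 𝔼[Φ(x, y, ξ)]`. -/
def phi (S : Problem d Ξ) (r : ℝ) (x : Fin d → ℝ) (y : Fin (m + 1) → ℝ) : ℝ :=
  ∫ ξ, S.Phi r x y ξ ∂S.law

/-- `U(x) = max_{y ∈ Y} φ(x, y)`. -/
def U (S : Problem d Ξ) (r : ℝ) (x : Fin d → ℝ) : ℝ :=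
  sSup ((fun y => S.phi r x y) '' S.Y)

/-- `L(y) = min_{x ∈ X} φ(x, y)`. -/
def L (S : Problem d Ξ) (r : ℝ) (y : Fin (m + 1) → ℝ) : ℝ :=
  sInf ((fun x => S.phi r x y) '' S.X)

/-- `G_x(x, y, ξ) = ∑ᵢ yᵢ F'ᵢ(x, ξᵢ)`, where `dF` stands for the chosen subgradients `F'ᵢ`. -/
def Gx (_S : Problem d Ξ) (dF : ∀ i, (Fin d → ℝ) → Ξ i → (Fin d → ℝ)) (x : Fin d → ℝ)
    (y : Fin (m + 1) → ℝ) (ξ : ∀ i, Ξ i) : Fin d → ℝ :=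
  ∑ i, y i • dF i x (ξ i)

/-- `G_y(x, y, ξ) = (F₀(x, ξ₀) - r₀, …, F_m(x, ξ_m) - r_m)`, which does not depend on `y`. -/
def Gy (S : Problem d Ξ) (r : ℝ) (x : Fin d → ℝ) (ξ : ∀ i, Ξ i) : Fin (m + 1) → ℝ :=
  fun i => S.F i x (ξ i) - S.levels r i

/-- The stochastic subgradient `G = (G_x, -G_y)`. -/
def G (S : Problem d Ξ) (r : ℝ) (dF : ∀ i, (Fin d → ℝ) → Ξ i → (Fin d → ℝ))
    (z : (Fin d → ℝ) × (Fin (m + 1) → ℝ)) (ξ : ∀ i, Ξ i) : (Fin d → ℝ) × (Fin (m + 1) → ℝ) :=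
  (S.Gx dF z.1 z.2 ξ, -S.Gy r z.1 ξ)

/-- The answer `out = (U, x̂)`, random over `(T, μ)`, is that of a stochastic oracle for
`(r, ε, δ)`: `x̂ ∈ X`, and `𝒫(r, x̂) - H(r) ≤ ε` and `|U - H(r)| ≤ ε` hold together with
probability at least `1 - δ`. -/
def IsStochasticOracle (S : Problem d Ξ) (r ε δ : ℝ) {T : Type*} [MeasurableSpace T]
    (μ : Measure T) (out : T → ℝ × (Fin d → ℝ)) : Prop :=
  (∀ τ, (out τ).2 ∈ S.X) ∧
    HoldsWithProbAtLeast μ (1 - δ) fun τ =>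
      S.P r (out τ).2 - S.H r ≤ ε ∧ |(out τ).1 - S.H r| ≤ ε

end Problem

/-! ## The mirror-descent setup -/

/-- Norms and distance-generating functions on `X` and on the simplex `Y`; the function on `X` is
bounded above, so that the diameter of `X` is finite. -/
structure Geometry {d m : ℕ} {Ξ : Fin (m + 1) → Type*} [∀ i, MeasurableSpace (Ξ i)]
    (S : Problem d Ξ) where
  normX : Seminorm ℝ (Fin d → ℝ)
  normY : Seminorm ℝ (Fin (m + 1) → ℝ)
  normX_definite : ∀ v, normX v = 0 → v = 0
  normY_definite : ∀ v, normY v = 0 → v = 0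
  αx : ℝ
  αy : ℝ
  ωx : (Fin d → ℝ) → ℝ
  ωy : (Fin (m + 1) → ℝ) → ℝ
  dωx : (Fin d → ℝ) → ((Fin d → ℝ) →L[ℝ] ℝ)
  dωy : (Fin (m + 1) → ℝ) → ((Fin (m + 1) → ℝ) →L[ℝ] ℝ)
  distX : IsDistanceGenerating S.X normX αx ωx dωx
  distY : IsDistanceGenerating S.Y normY αy ωy dωy
  bddAbove_ωx : BddAbove (ωx '' S.X)

namespace Geometry

variable {d m : ℕ} {Ξ : Fin (m + 1) → Type*} [∀ i, MeasurableSpace (Ξ i)] {S : Problem d Ξ}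

/-- The diameter `D_x`. -/
def Dx (B : Geometry S) : ℝ := diameter S.X B.ωx

/-- The diameter `D_y`. -/
def Dy (B : Geometry S) : ℝ := diameter S.Y B.ωy

/-- `ω_z(x, y) = ω_x(x) / (2 D_x²) + ω_y(y) / (2 D_y²)`. -/
def ωz (B : Geometry S) (z : (Fin d → ℝ) × (Fin (m + 1) → ℝ)) : ℝ :=
  B.ωx z.1 / (2 * B.Dx ^ 2) + B.ωy z.2 / (2 * B.Dy ^ 2)

/-- `∇ω_z(z)ᵀ w`. -/
def dωz (B : Geometry S) (z w : (Fin d → ℝ) × (Fin (m + 1) → ℝ)) : ℝ :=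
  B.dωx z.1 w.1 / (2 * B.Dx ^ 2) + B.dωy z.2 w.2 / (2 * B.Dy ^ 2)

/-- The Bregman divergence `V(z₁, z₂) = ω_z(z₂) - [ω_z(z₁) + ∇ω_z(z₁)ᵀ (z₂ - z₁)]`. -/
def V (B : Geometry S) (z₁ z₂ : (Fin d → ℝ) × (Fin (m + 1) → ℝ)) : ℝ :=
  B.ωz z₂ - (B.ωz z₁ + B.dωz z₁ (z₂ - z₁))

/-- The prox-mapping `argmin_{z ∈ Z} {ζᵀ (z - z₁) + V(z₁, z)}` with `Z = X × Y`. -/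
def prox (B : Geometry S) (z₁ ζ : (Fin d → ℝ) × (Fin (m + 1) → ℝ)) :
    (Fin d → ℝ) × (Fin (m + 1) → ℝ) :=
  argminOn (S.X ×ˢ S.Y) fun z =>
    ζ.1 ⬝ᵥ (z.1 - z₁.1) + ζ.2 ⬝ᵥ (z.2 - z₁.2) + B.V z₁ z

/-- `M = √(2 D_x² M_x² / α_x + 2 D_y² M_y² / α_y)`. -/
def M (B : Geometry S) (Mx My : ℝ) : ℝ :=
  √(2 * B.Dx ^ 2 / B.αx * Mx ^ 2 + 2 * B.Dy ^ 2 / B.αy * My ^ 2)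

/-- The iterates `z⁽ᵗ⁾` of stochastic mirror descent with step lengths `γ` along the samples
`ξ⁽⁰⁾, ξ⁽¹⁾, …`. -/
def iterate (B : Geometry S) (r : ℝ) (dF : ∀ i, (Fin d → ℝ) → Ξ i → (Fin d → ℝ)) (γ : ℕ → ℝ)
    (ξ : ℕ → ∀ i, Ξ i) : ℕ → (Fin d → ℝ) × (Fin (m + 1) → ℝ)
  | 0 => argminOn (S.X ×ˢ S.Y) B.ωz
  | t + 1 =>
    B.prox (B.iterate r dF γ ξ t) (γ t • S.G r dF (B.iterate r dF γ ξ t) (ξ t))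

/-- The averages `z̄⁽ᵗ⁾ = (x̄⁽ᵗ⁾, ȳ⁽ᵗ⁾) = (∑_{s ≤ t} γ_s z⁽ˢ⁾) / ∑_{s ≤ t} γ_s`. -/
def average (B : Geometry S) (r : ℝ) (dF : ∀ i, (Fin d → ℝ) → Ξ i → (Fin d → ℝ)) (γ : ℕ → ℝ)
    (ξ : ℕ → ∀ i, Ξ i) (t : ℕ) : (Fin d → ℝ) × (Fin (m + 1) → ℝ) :=
  (∑ s ∈ Finset.range (t + 1), γ s)⁻¹ •
    ∑ s ∈ Finset.range (t + 1), γ s • B.iterate r dF γ ξ s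

/-- The output `(U(x̄⁽ᴺ⁾), x̄⁽ᴺ⁾)` of stochastic mirror descent with iteration limit `N`. -/
def output (B : Geometry S) (r : ℝ) (dF : ∀ i, (Fin d → ℝ) → Ξ i → (Fin d → ℝ)) (γ : ℕ → ℝ)
    (N : ℕ) (ξ : ℕ → ∀ i, Ξ i) : ℝ × (Fin d → ℝ) :=
  (S.U r (B.average r dF γ ξ N).1, (B.average r dF γ ξ N).1)

/-- The `dF i x ξᵢ` are subgradients of `Fᵢ(·, ξᵢ)` at `x`, measurable in `(x, ξᵢ)`, for which
`G_x` and `G_y` are light-tailed with constants `M_x` and `M_y`. -/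
structure LightTailed (B : Geometry S) (r : ℝ) (dF : ∀ i, (Fin d → ℝ) → Ξ i → (Fin d → ℝ))
    (Mx My : ℝ) : Prop where
  Mx_pos : 0 < Mx
  My_pos : 0 < My
  subgradient : ∀ i, ∀ x ∈ S.X, ∀ ξ, dF i x ξ ∈ subdifferentialOn S.X (fun u => S.F i u ξ) x
  measurable : ∀ i, Measurable fun q : S.X × Ξ i => dF i q.1 q.2
  lightTail_x : ∀ x ∈ S.X, ∀ y ∈ S.Y,
    ∫⁻ ξ, ENNReal.ofReal (Real.exp (dualNorm B.normX (S.Gx dF x y ξ) ^ 2 / Mx ^ 2)) ∂S.law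
      ≤ ENNReal.ofReal (Real.exp 1)
  lightTail_y : ∀ x ∈ S.X,
    ∫⁻ ξ, ENNReal.ofReal (Real.exp (dualNorm B.normY (S.Gy r x ξ) ^ 2 / My ^ 2)) ∂S.law
      ≤ ENNReal.ofReal (Real.exp 1)

end Geometry

/-! ## Constants -/

/-- The step lengths `γ_t = 1 / (M √(t + 1))`. -/
def stepLength (M : ℝ) (t : ℕ) : ℝ := 1 / (M * √((t : ℝ) + 1))

/-- `Ω(δ) = max {√(12 ln(24/δ)), (4/3) ln(24/δ)}`. -/
def OmegaConst (δ : ℝ) : ℝ :=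
  max (√(12 * Real.log (24 / δ))) (4 / 3 * Real.log (24 / δ))

/-- The iteration bound `W(δ, ε)`. -/
def iterationBound (M δ ε : ℝ) : ℝ :=
  max 6 ((8 * (10 * M * OmegaConst δ + 4.5 * M) / ε *
    Real.log (4 * (10 * M * OmegaConst δ + 4.5 * M) / ε)) ^ 2 - 2)

end SMD

end

/-! Convexity in `x` and linearity in `y` bound the gap `φ(x̄, v) - φ(u, ȳ)` at the averaged point
by the `γ`-weighted mean of `g(z_s)(z_s - (u, v))`, where `g = 𝔼 G` (`convexOn_gap`, `gap_le`). It
is therefore enough to find one event of probability at least `1 - δ` on which `∑ γ_s g(z_s)(z_s -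
w) ≤ ε ∑ γ_s` for all `w ∈ X × Y` simultaneously.

Write `g = G - Δ`. The `G` part is the pathwise regret of mirror descent, at most `1 + ½ ∑ γ_s²
q(G_s)` with `q` the squared dual norm (`sum_pairing_le`). The part `-∑ γ_s Δ_s(z_s - w)` is
delicate because `w` may depend on the noise. A second, auxiliary mirror descent `v_s` driven by
`-γ_s Δ_s` splits it into the regret of `v`, again uniform in `w`, and `∑ γ_s Δ_s(v_s - z_s)`, which
is free of `w` and a martingale (`exists_event_regret_le`).

The norm on the product is weighted so that `ω_z` has modulus and oscillation at most one, and `𝔼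
exp(q(G)/M²) ≤ e`. As `γ_s² M² = 1/(s+1)`, all sums are harmonic. Chernoff's bound along the
recursion (`measure_sum_ge_le`) is applied twice: to the sum of squared norms, and to the
martingale, whose increments are sub-Gaussian (`exp_moment_noise`). The regret is then of order `log
t`, while `∑ γ_s ≥ √(t+1)/M`; the bound `W` is a time from which the latter wins (`regret_div_le`).

Measurability is handled by carrying dual vectors `η_t` with `z_t = proxPoint η_t`. Strong convexity
makes `proxPoint` Lipschitz, and its values always lie where `dω` is continuous, so each step is a
measurable map on the whole dual space and the one-step moment bounds hold at every state. The
oracle claim follows from `U = 𝒫` on `X` and weak duality (`P_sub_H_mem`). -/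

/-! ## Mirror descent on a compact convex set -/

/-- The points of `K` at which `ω` has a subgradient relative to `K`. -/
def subgradientDomain {E : Type*} [NormedAddCommGroup E] [NormedSpace ℝ E] (K : Set E)
    (ω : E → ℝ) : Set E :=
  {x ∈ K | ∃ g : E →L[ℝ] ℝ, ∀ u ∈ K, ω x + g (u - x) ≤ ω u}

/-- A prox-function `ω` on a compact convex set `K`, strongly convex with respect to the squared
norm `Q`, with dual squared norm `q`. -/
structure IsProxSetup {E : Type*} [NormedAddCommGroup E] [NormedSpace ℝ E] (K : Set E)
    (ω : E → ℝ) (dω : E → (E →L[ℝ] ℝ)) (Q : E → ℝ) (q : (E →L[ℝ] ℝ) → ℝ) : Prop where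
  isCompact : IsCompact K
  convex : Convex ℝ K
  nonempty : K.Nonempty
  continuousOn : ContinuousOn ω K
  stronglyConvex : ∀ u ∈ K, ∀ v ∈ K, ∀ a b : ℝ, 0 ≤ a → 0 ≤ b → a + b = 1 →
    ω (a • u + b • v) ≤ a * ω u + b * ω v - 1 / 2 * (a * b) * Q (u - v)
  coercive : ∃ c > 0, ∀ w, c * ‖w‖ ^ 2 ≤ Q w
  hasDerivative : ∀ x ∈ subgradientDomain K ω, HasFDerivWithinAt ω (dω x) K x
  continuousOn_derivative : ContinuousOn dω (subgradientDomain K ω)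
  pairing : ∀ ζ w, (ζ w) ^ 2 ≤ q ζ * Q w
  q_nonneg : ∀ ζ, 0 ≤ q ζ
  q_smul : ∀ (c : ℝ) ζ, q (c • ζ) = c ^ 2 * q ζ
  q_sub_le : ∀ ζ ζ', q (ζ - ζ') ≤ 2 * q ζ + 2 * q ζ'
  q_continuous : Continuous q

/-- The minimizer of `η + ω` over `K`. -/
noncomputable def proxPoint {E : Type*} [NormedAddCommGroup E] [NormedSpace ℝ E] (K : Set E)
    (ω : E → ℝ) (η : E →L[ℝ] ℝ) : E :=
  SMD.argminOn K fun z => η z + ω z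

/-- The Bregman divergence of `ω`. -/
def bregman {E : Type*} [NormedAddCommGroup E] [NormedSpace ℝ E] (ω : E → ℝ)
    (dω : E → (E →L[ℝ] ℝ)) (z u : E) : ℝ :=
  ω u - ω z - dω z (u - z)

theorem SMD.argminOn_spec {E : Type*} [Nonempty E] {K : Set E} {h : E → ℝ}
    (hex : ∃ z ∈ K, ∀ w ∈ K, h z ≤ h w) :
    SMD.argminOn K h ∈ K ∧ ∀ w ∈ K, h (SMD.argminOn K h) ≤ h w := by
  obtain ⟨z, hz, hm⟩ := hex
  exact Classical.epsilon_spec (p := fun z => z ∈ K ∧ ∀ w ∈ K, h z ≤ h w) ⟨z, hz, hm⟩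

/-- The predicates given to the choice operator coincide, so the chosen points agree without any
appeal to uniqueness of the minimizer. -/
theorem SMD.argminOn_congr {E : Type*} [Nonempty E] {K : Set E} {h h' : E → ℝ} (c : ℝ)
    (hh : ∀ z, h z = h' z + c) : SMD.argminOn K h = SMD.argminOn K h' := by
  unfold SMD.argminOn
  congr 1
  funext z
  simp [hh]

/-- A derivative within `K` is accessible only through segments inside `K`; this form lets convexity
inequalities be divided by `t` and passed to the limit. -/
theorem tendsto_directional_slope {E : Type*} [NormedAddCommGroup E] [NormedSpace ℝ E]
    {K : Set E} (hK : Convex ℝ K) {ω : E → ℝ} {f' : E →L[ℝ] ℝ} {z u : E} (hz : z ∈ K)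
    (hu : u ∈ K) (h : HasFDerivWithinAt ω f' K z) :
    Filter.Tendsto (fun t : ℝ => t⁻¹ * (ω (t • u + (1 - t) • z) - ω z))
      (nhdsWithin 0 (Set.Ioo 0 1)) (nhds (f' (u - z))) := by
  have hline : HasDerivWithinAt (fun t : ℝ => t • u + (1 - t) • z) (u - z) (Set.Ioo 0 1) 0 := by
    have h1 : HasDerivAt (fun t : ℝ => t • u + (1 - t) • z) ((1 : ℝ) • u + (-1 : ℝ) • z) 0 :=
      ((hasDerivAt_id (0 : ℝ)).smul_const u).add
        (((hasDerivAt_id (0 : ℝ)).const_sub 1).smul_const z)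
    simpa [sub_eq_add_neg] using h1.hasDerivWithinAt
  have hmaps : Set.MapsTo (fun t : ℝ => t • u + (1 - t) • z) (Set.Ioo 0 1) K := fun t ht =>
    hK hu hz ht.1.le (by linarith [ht.2]) (by ring)
  have h0 : (fun t : ℝ => t • u + (1 - t) • z) 0 = z := by simp
  have hcomp : HasDerivWithinAt (fun t : ℝ => ω (t • u + (1 - t) • z)) (f' (u - z))
      (Set.Ioo 0 1) 0 := by
    have h' : HasFDerivWithinAt ω f' K ((fun t : ℝ => t • u + (1 - t) • z) 0) := by
      rw [h0]; exact h
    exact h'.comp_hasDerivWithinAt 0 hline hmaps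
  rw [hasDerivWithinAt_iff_tendsto_slope' (by simp)] at hcomp
  refine hcomp.congr fun t => ?_
  simp [slope_def_field, div_eq_inv_mul]

/-! ### Prox-points, Bregman divergences and the regret of mirror descent. -/

namespace IsProxSetup

variable {E : Type*} [NormedAddCommGroup E] [NormedSpace ℝ E] {K : Set E}
  {ω : E → ℝ} {dω : E → (E →L[ℝ] ℝ)} {Q : E → ℝ} {q : (E →L[ℝ] ℝ) → ℝ}

theorem Q_nonneg (S : IsProxSetup K ω dω Q q) (w : E) : 0 ≤ Q w := by
  obtain ⟨c, hc, h⟩ := S.coercive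
  exact le_trans (by positivity) (h w)

theorem proxPoint_spec (S : IsProxSetup K ω dω Q q) (η : E →L[ℝ] ℝ) :
    proxPoint K ω η ∈ K ∧
      ∀ w ∈ K, η (proxPoint K ω η) + ω (proxPoint K ω η) ≤ η w + ω w := by
  refine SMD.argminOn_spec ?_
  obtain ⟨z, hz, hm⟩ := S.isCompact.exists_isMinOn S.nonempty
    ((η.continuous.continuousOn).add S.continuousOn)
  exact ⟨z, hz, fun w hw => hm hw⟩

theorem proxPoint_mem (S : IsProxSetup K ω dω Q q) (η : E →L[ℝ] ℝ) : proxPoint K ω η ∈ K :=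
  (S.proxPoint_spec η).1

/-- Minimality of `η + ω` says exactly that `-η` is a subgradient, so `dω` is meaningful at every
prox-point. -/
theorem proxPoint_mem_domain (S : IsProxSetup K ω dω Q q) (η : E →L[ℝ] ℝ) :
    proxPoint K ω η ∈ subgradientDomain K ω := by
  refine ⟨S.proxPoint_mem η, -η, fun u hu => ?_⟩
  have := (S.proxPoint_spec η).2 u hu
  simp only [neg_apply, map_sub]
  linarith

/-- Quadratic growth of `η + ω` at its minimizer. -/
theorem proxPoint_growth (S : IsProxSetup K ω dω Q q) (η : E →L[ℝ] ℝ) {u : E} (hu : u ∈ K) :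
    ω (proxPoint K ω η) - η (u - proxPoint K ω η) + 1 / 2 * Q (u - proxPoint K ω η) ≤ ω u := by
  obtain ⟨hx, hmin⟩ := S.proxPoint_spec η
  set x := proxPoint K ω η
  -- Compare the minimizer with the point at parameter `t` on the segment towards `u` and cancel a
  -- factor `t`; the growth estimate is the limit `t → 0`.
  have key : ∀ t : ℝ, 0 < t → t < 1 →
      (1 - t) * (1 / 2 * Q (u - x)) ≤ ω u + η u - ω x - η x := by
    intro t h0 h1
    have h2 := hmin _ (S.convex hu hx h0.le (by linarith : (0 : ℝ) ≤ 1 - t) (by ring))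
    have h3 := S.stronglyConvex u hu x hx t (1 - t) h0.le (by linarith) (by ring)
    simp only [map_add, map_smul, smul_eq_mul] at h2
    have h4 : t * ((1 - t) * (1 / 2 * Q (u - x))) ≤ t * (ω u + η u - ω x - η x) := by
      nlinarith
    exact le_of_mul_le_mul_left h4 h0
  have hlim : Filter.Tendsto (fun t : ℝ => (1 - t) * (1 / 2 * Q (u - x)))
      (nhdsWithin 0 (Set.Ioo 0 1)) (nhds ((1 - 0) * (1 / 2 * Q (u - x)))) :=
    ((by fun_prop : Continuous fun t : ℝ => (1 - t) * (1 / 2 * Q (u - x))).tendsto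
      0).mono_left nhdsWithin_le_nhds
  have : (nhdsWithin (0 : ℝ) (Set.Ioo 0 1)).NeBot := left_nhdsWithin_Ioo_neBot one_pos
  have := le_of_tendsto hlim
    (Filter.eventually_of_mem self_mem_nhdsWithin fun t ht => key t ht.1 ht.2)
  rw [map_sub]
  linarith

/-- Adding the quadratic growth inequalities at the two minimizers gives `c‖x - x'‖² ≤ (η' - η)(x -
x')`, hence a Lipschitz constant `c⁻¹`. This is the source of the measurability of the iterates. -/
theorem continuous_proxPoint (S : IsProxSetup K ω dω Q q) : Continuous (proxPoint K ω) := by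
  obtain ⟨c, hc, hQ⟩ := S.coercive
  have hL : LipschitzWith (Real.toNNReal c⁻¹) (proxPoint K ω) := by
    refine LipschitzWith.of_dist_le_mul fun η η' => ?_
    rw [dist_eq_norm, dist_eq_norm, Real.coe_toNNReal _ (inv_nonneg.2 hc.le)]
    set x := proxPoint K ω η with hxdef
    set x' := proxPoint K ω η' with hxdef'
    have h1 := S.proxPoint_growth η (S.proxPoint_mem η')
    have h2 := S.proxPoint_growth η' (S.proxPoint_mem η)
    rw [← hxdef, ← hxdef'] at h1 h2
    have h3 := hQ (x - x')
    have h4 := hQ (x' - x)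
    rw [norm_sub_rev] at h4
    have h5 : (η' - η) (x - x') ≤ ‖η' - η‖ * ‖x - x'‖ :=
      (le_abs_self _).trans ((η' - η).le_opNorm _)
    rw [norm_sub_rev η' η] at h5
    simp only [sub_apply, map_sub] at h1 h2 h5
    have h6 : c * ‖x - x'‖ ^ 2 ≤ ‖η - η'‖ * ‖x - x'‖ := by nlinarith
    rcases (norm_nonneg (x - x')).eq_or_lt with h0 | h0
    · rw [← h0]; positivity
    · rw [inv_mul_eq_div, le_div_iff₀ hc]
      have : (‖x - x'‖ * c) * ‖x - x'‖ ≤ ‖η - η'‖ * ‖x - x'‖ := by nlinarith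
      exact le_of_mul_le_mul_right this h0
  exact hL.continuous

theorem continuous_derivative_proxPoint (S : IsProxSetup K ω dω Q q) :
    Continuous fun η => dω (proxPoint K ω η) :=
  S.continuousOn_derivative.comp_continuous S.continuous_proxPoint S.proxPoint_mem_domain

theorem proxPoint_first_order (S : IsProxSetup K ω dω Q q) (η : E →L[ℝ] ℝ) {u : E}
    (hu : u ∈ K) :
    0 ≤ η (u - proxPoint K ω η) + dω (proxPoint K ω η) (u - proxPoint K ω η) := by
  obtain ⟨hx, hmin⟩ := S.proxPoint_spec η
  have hlim := tendsto_directional_slope S.convex hx hu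
    (S.hasDerivative _ (S.proxPoint_mem_domain η))
  set x := proxPoint K ω η
  have : (nhdsWithin (0 : ℝ) (Set.Ioo 0 1)).NeBot := left_nhdsWithin_Ioo_neBot one_pos
  have : -η (u - x) ≤ dω x (u - x) := by
    refine ge_of_tendsto hlim (Filter.eventually_of_mem self_mem_nhdsWithin fun t ht => ?_)
    have h2 := hmin _ (S.convex hu hx ht.1.le (by linarith [ht.2] : (0 : ℝ) ≤ 1 - t) (by ring))
    simp only [map_add, map_smul, smul_eq_mul] at h2
    rw [← div_eq_inv_mul, le_div_iff₀ ht.1, map_sub]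
    nlinarith
  linarith

/-- Strong convexity bounds the difference quotients of `ω` from `z` towards `u`; their limit is the
derivative term of the Bregman divergence. -/
theorem half_le_bregman (S : IsProxSetup K ω dω Q q) {z u : E}
    (hz : z ∈ subgradientDomain K ω) (hu : u ∈ K) :
    1 / 2 * Q (u - z) ≤ bregman ω dω z u := by
  have hlim := tendsto_directional_slope S.convex hz.1 hu (S.hasDerivative _ hz)
  have : (nhdsWithin (0 : ℝ) (Set.Ioo 0 1)).NeBot := left_nhdsWithin_Ioo_neBot one_pos
  have hlim2 : Filter.Tendsto (fun t : ℝ => ω u - ω z - (1 - t) * (1 / 2 * Q (u - z)))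
      (nhdsWithin 0 (Set.Ioo 0 1)) (nhds (ω u - ω z - (1 - 0) * (1 / 2 * Q (u - z)))) :=
    ((by fun_prop : Continuous fun t : ℝ => ω u - ω z - (1 - t) * (1 / 2 * Q (u - z))).tendsto
      0).mono_left nhdsWithin_le_nhds
  have := le_of_tendsto_of_tendsto hlim hlim2
    (Filter.eventually_of_mem self_mem_nhdsWithin fun t ht => by
      have h3 := S.stronglyConvex u hu z hz.1 t (1 - t) ht.1.le (by linarith [ht.2]) (by ring)
      show t⁻¹ * _ ≤ _
      rw [← div_eq_inv_mul, div_le_iff₀ ht.1]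
      nlinarith)
  unfold bregman
  linarith

theorem young (S : IsProxSetup K ω dω Q q) (ζ : E →L[ℝ] ℝ) (w : E) :
    ζ w ≤ 1 / 2 * q ζ + 1 / 2 * Q w := by
  have h := S.pairing ζ w
  have h1 := S.q_nonneg ζ
  have h2 := S.Q_nonneg w
  refine le_of_sq_le_sq ?_ (by positivity)
  nlinarith [sq_nonneg (q ζ - Q w)]

/-- One step of mirror descent. -/
theorem bregman_step (S : IsProxSetup K ω dω Q q) {z u : E} (ζ : E →L[ℝ] ℝ)
    (hz : z ∈ subgradientDomain K ω) (hu : u ∈ K) :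
    bregman ω dω (proxPoint K ω (ζ - dω z)) u
      ≤ bregman ω dω z u - ζ (z - u) + 1 / 2 * q ζ := by
  have h1 := S.proxPoint_first_order (ζ - dω z) hu
  have h2 := S.half_le_bregman hz (S.proxPoint_mem (ζ - dω z))
  -- The movement of the iterate costs at most `½ q(ζ) + ½ Q`, and `half_le_bregman` between the old
  -- and the new point pays for the `½ Q`.
  have h3 := S.young (-ζ) (proxPoint K ω (ζ - dω z) - z)
  have h4 : q (-ζ) = q ζ := by
    have := S.q_smul (-1) ζ
    have h5 : (-1 : ℝ) • ζ = -ζ := by ext w; simp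
    rw [h5] at this
    linarith
  rw [h4] at h3
  unfold bregman at *
  simp only [sub_apply, neg_apply, map_sub] at *
  linarith

/-- The regret bound of mirror descent, started at the minimizer of `ω`. -/
theorem sum_pairing_le (S : IsProxSetup K ω dω Q q) (hdiam : ∀ u ∈ K, ∀ v ∈ K, ω u - ω v ≤ 1)
    (ζ : ℕ → (E →L[ℝ] ℝ)) (η : ℕ → (E →L[ℝ] ℝ)) (h0 : η 0 = 0)
    (hη : ∀ t, η (t + 1) = ζ t - dω (proxPoint K ω (η t))) (t : ℕ) {u : E} (hu : u ∈ K) :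
    ∑ s ∈ Finset.range t, ζ s (proxPoint K ω (η s) - u)
      ≤ 1 + 1 / 2 * ∑ s ∈ Finset.range t, q (ζ s) := by
  have key : ∀ t : ℕ, bregman ω dω (proxPoint K ω (η t)) u
      + ∑ s ∈ Finset.range t, ζ s (proxPoint K ω (η s) - u)
      ≤ 1 + 1 / 2 * ∑ s ∈ Finset.range t, q (ζ s) := by
    intro t
    induction t with
    | zero =>
      -- At the minimizer of `ω` the derivative term is nonnegative, so the initial divergence is at
      -- most the oscillation of `ω`, namely `1`.
      have h1 := S.proxPoint_first_order (η 0) hu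
      have h2 := hdiam u hu _ (S.proxPoint_mem (η 0))
      rw [h0] at h1 h2 ⊢
      simp only [zero_apply, zero_add, Finset.range_zero, Finset.sum_empty,
        mul_zero, add_zero, bregman] at *
      linarith
    | succ t ih =>
      rw [Finset.sum_range_succ, Finset.sum_range_succ]
      have := S.bregman_step (ζ t) (S.proxPoint_mem_domain (η t)) hu
      rw [← hη] at this
      linarith
  have h1 := S.half_le_bregman (S.proxPoint_mem_domain (η t)) hu
  have h2 := S.Q_nonneg (u - proxPoint K ω (η t))
  linarith [key t]

/-- Distances to the minimizer of `ω` are controlled by the oscillation of `ω`. -/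
theorem sq_pairing_sub_le (S : IsProxSetup K ω dω Q q)
    (hdiam : ∀ u ∈ K, ∀ v ∈ K, ω u - ω v ≤ 1) (ζ : E →L[ℝ] ℝ) {u v : E} (hu : u ∈ K)
    (hv : v ∈ K) : (ζ (u - v)) ^ 2 ≤ 8 * q ζ := by
  have key : ∀ u ∈ K, (ζ (u - proxPoint K ω 0)) ^ 2 ≤ 2 * q ζ := by
    intro u hu
    have h1 := S.proxPoint_growth 0 hu
    have h2 := hdiam u hu _ (S.proxPoint_mem 0)
    have h3 := S.pairing ζ (u - proxPoint K ω 0)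
    have h4 := S.q_nonneg ζ
    simp only [zero_apply] at h1
    -- Each point is within squared distance `2` of the minimizer, which gives `2 q(ζ)`; the
    -- inequality `(a - b)² ≤ 2a² + 2b²` then produces the `8`.
    have h5 : Q (u - proxPoint K ω 0) ≤ 2 := by linarith
    nlinarith [mul_le_mul_of_nonneg_left h5 h4]
  have h1 := key u hu
  have h2 := key v hv
  have h3 : ζ (u - v) = ζ (u - proxPoint K ω 0) - ζ (v - proxPoint K ω 0) := by
    rw [← map_sub]; congr 1; abel
  rw [h3]
  nlinarith [sq_nonneg (ζ (u - proxPoint K ω 0) + ζ (v - proxPoint K ω 0))]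

end IsProxSetup

/-! ## Exponential moments -/

/-- On `[-1, 1]` it follows from `exp x ≤ 1 + x + x²`; for `x < -1` the left side is at most `1`,
and for `x > 1` one has `x ≤ x²`. The linear term disappears for a centred variable. -/
theorem Real.exp_le_add_exp_sq (x : ℝ) : Real.exp x ≤ x + Real.exp (x ^ 2) := by
  have h1 := Real.add_one_le_exp (x ^ 2)
  rcases le_or_gt x 1 with hx | hx
  · rcases le_or_gt (-1) x with hx' | hx'
    · have := (abs_le.1 (Real.abs_exp_sub_one_sub_id_le (abs_le.2 ⟨hx', hx⟩))).2
      linarith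
    · have : Real.exp x ≤ 1 := Real.exp_le_one_iff.2 (by linarith)
      nlinarith
  · have : Real.exp x ≤ Real.exp (x ^ 2) := Real.exp_le_exp.2 (by nlinarith)
    linarith

/-- Convexity of `exp` between `x - 1` and `0`. Taking expectations when `𝔼 exp X ≤ e` yields `𝔼
exp(aX) ≤ exp a`, a pointwise substitute for Jensen's inequality. -/
theorem Real.exp_mul_le_of_le_one {a : ℝ} (x : ℝ) (h0 : 0 ≤ a) (h1 : a ≤ 1) :
    Real.exp (a * x) ≤ Real.exp a * (a * Real.exp (-1) * Real.exp x + (1 - a)) := by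
  have h := convexOn_exp.2 (Set.mem_univ (x - 1)) (Set.mem_univ 0) h0
    (by linarith : (0 : ℝ) ≤ 1 - a) (by ring)
  simp only [smul_eq_mul, mul_zero, add_zero, Real.exp_zero, mul_one] at h
  have h2 : Real.exp (a * x) = Real.exp a * Real.exp (a * (x - 1)) := by
    rw [← Real.exp_add]; congr 1; ring
  have h3 : Real.exp (x - 1) = Real.exp (-1) * Real.exp x := by
    rw [← Real.exp_add]; congr 1; ring
  rw [h2, mul_assoc a, ← h3]
  gcongr

section Moments

variable {Ω' : Type*} [MeasurableSpace Ω'] {ν : Measure Ω'} {X : Ω' → ℝ}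

theorem integrable_of_lintegral_ofReal_le {f : Ω' → ℝ} {c : ℝ} (hf : Measurable f)
    (h0 : ∀ ω, 0 ≤ f ω) (h : ∫⁻ ω, ENNReal.ofReal (f ω) ∂ν ≤ ENNReal.ofReal c) :
    Integrable f ν := by
  refine ⟨hf.aestronglyMeasurable, ?_⟩
  rw [hasFiniteIntegral_iff_ofReal (Filter.Eventually.of_forall h0)]
  exact h.trans_lt ENNReal.ofReal_lt_top

theorem integral_le_of_lintegral_ofReal_le {f : Ω' → ℝ} {c : ℝ} (hf : Measurable f) (hc : 0 ≤ c)
    (h0 : ∀ ω, 0 ≤ f ω) (h : ∫⁻ ω, ENNReal.ofReal (f ω) ∂ν ≤ ENNReal.ofReal c) :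
    ∫ ω, f ω ∂ν ≤ c := by
  rw [integral_eq_lintegral_of_nonneg_ae (Filter.Eventually.of_forall h0)
    hf.aestronglyMeasurable]
  exact ENNReal.toReal_le_of_le_ofReal hc h

theorem lintegral_ofReal_le_of_integral_le {f : Ω' → ℝ} {c : ℝ} (hf : Integrable f ν)
    (h0 : ∀ ω, 0 ≤ f ω) (h : ∫ ω, f ω ∂ν ≤ c) :
    ∫⁻ ω, ENNReal.ofReal (f ω) ∂ν ≤ ENNReal.ofReal c := by
  rw [← ofReal_integral_eq_lintegral_ofReal hf (Filter.Eventually.of_forall h0)]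
  exact ENNReal.ofReal_le_ofReal h

theorem integrable_of_exp_moment (hX : Measurable X) (h0 : ∀ ω, 0 ≤ X ω)
    (h : ∫⁻ ω, ENNReal.ofReal (Real.exp (X ω)) ∂ν ≤ ENNReal.ofReal (Real.exp 1)) :
    Integrable X ν := by
  refine (integrable_of_lintegral_ofReal_le hX.exp (fun ω => (Real.exp_pos _).le) h).mono'
    hX.aestronglyMeasurable (Filter.Eventually.of_forall fun ω => ?_)
  rw [Real.norm_of_nonneg (h0 ω)]
  linarith [Real.add_one_le_exp (X ω)]

theorem integral_le_one_of_exp_moment (hX : Measurable X) (h0 : ∀ ω, 0 ≤ X ω)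
    (h : ∫⁻ ω, ENNReal.ofReal (Real.exp (X ω)) ∂ν ≤ ENNReal.ofReal (Real.exp 1)) :
    ∫ ω, X ω ∂ν ≤ 1 := by
  have hi := integrable_of_lintegral_ofReal_le hX.exp (fun ω => (Real.exp_pos _).le) h
  have h1 := integral_le_of_lintegral_ofReal_le hX.exp (Real.exp_pos 1).le
    (fun ω => (Real.exp_pos _).le) h
  have h2 : ∫ ω, X ω ∂ν ≤ ∫ ω, Real.exp (-1) * Real.exp (X ω) ∂ν := by
    refine integral_mono (integrable_of_exp_moment hX h0 h) (hi.const_mul _) fun ω => ?_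
    have := Real.add_one_le_exp (X ω - 1)
    show X ω ≤ Real.exp (-1) * Real.exp (X ω)
    rw [← Real.exp_add, neg_add_eq_sub]
    linarith
  rw [integral_const_mul] at h2
  have h3 : Real.exp (-1) * Real.exp 1 = 1 := by rw [← Real.exp_add]; simp
  nlinarith [mul_le_mul_of_nonneg_left h1 (Real.exp_pos (-1)).le]

variable [IsProbabilityMeasure ν]

theorem exp_moment_scale (hX : Measurable X)
    (h : ∫⁻ ω, ENNReal.ofReal (Real.exp (X ω)) ∂ν ≤ ENNReal.ofReal (Real.exp 1))
    {a : ℝ} (h0 : 0 ≤ a) (h1 : a ≤ 1) :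
    Integrable (fun ω => Real.exp (a * X ω)) ν ∧
      ∫ ω, Real.exp (a * X ω) ∂ν ≤ Real.exp a := by
  have hi := integrable_of_lintegral_ofReal_le hX.exp (fun ω => (Real.exp_pos _).le) h
  have h2 := integral_le_of_lintegral_ofReal_le hX.exp (Real.exp_pos 1).le
    (fun ω => (Real.exp_pos _).le) h
  have hdom : Integrable
      (fun ω => Real.exp a * (a * Real.exp (-1) * Real.exp (X ω) + (1 - a))) ν :=
    ((hi.const_mul _).add (integrable_const _)).const_mul _
  have hint : Integrable (fun ω => Real.exp (a * X ω)) ν := by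
    refine hdom.mono' (hX.const_mul a).exp.aestronglyMeasurable
      (Filter.Eventually.of_forall fun ω => ?_)
    rw [Real.norm_of_nonneg (Real.exp_pos _).le]
    exact Real.exp_mul_le_of_le_one _ h0 h1
  refine ⟨hint, (integral_mono hint hdom fun ω => Real.exp_mul_le_of_le_one _ h0 h1).trans ?_⟩
  rw [integral_const_mul, integral_add (hi.const_mul _) (integrable_const _),
    integral_const_mul, integral_const]
  simp only [probReal_univ, one_smul]
  have h3 : Real.exp (-1) * Real.exp 1 = 1 := by rw [← Real.exp_add]; simp
  have h4 : a * Real.exp (-1) * ∫ ω, Real.exp (X ω) ∂ν ≤ a := by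
    calc _ ≤ a * Real.exp (-1) * Real.exp 1 := by gcongr
      _ = a := by rw [mul_assoc, h3, mul_one]
  calc _ ≤ Real.exp a * (a + (1 - a)) := by gcongr
    _ = Real.exp a := by ring

/-- A centred variable with light tails is sub-Gaussian. -/
theorem exp_moment_of_centred {ψ : Ω' → ℝ} (hψ : Measurable ψ) (hi : Integrable ψ ν)
    (hc : ∫ ω, ψ ω ∂ν = 0) {v : ℝ} (hv : 0 < v)
    (h : ∫⁻ ω, ENNReal.ofReal (Real.exp (ψ ω ^ 2 / v)) ∂ν ≤ ENNReal.ofReal (Real.exp 1))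
    (l : ℝ) :
    ∫⁻ ω, ENNReal.ofReal (Real.exp (l * ψ ω)) ∂ν ≤ ENNReal.ofReal (Real.exp (l ^ 2 * v)) := by
  have hm : Measurable fun ω => ψ ω ^ 2 / v := (hψ.pow_const 2).div_const v
  -- For small `l` the linear term of `exp x ≤ x + exp(x²)` integrates to zero. For large `l`, `lψ ≤
  -- ½ l²v + ½ ψ²/v`, and the resulting extra `½` is at most `½ l²v`.
  rcases le_or_gt (l ^ 2 * v) 1 with hl | hl
  · obtain ⟨h1, h2⟩ := exp_moment_scale hm h (by positivity : 0 ≤ l ^ 2 * v) hl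
    have heq : ∀ ω, l ^ 2 * v * (ψ ω ^ 2 / v) = (l * ψ ω) ^ 2 := fun ω => by
      field_simp
    simp only [heq] at h1 h2
    have hdom : Integrable (fun ω => l * ψ ω + Real.exp ((l * ψ ω) ^ 2)) ν :=
      (hi.const_mul l).add h1
    have hint : Integrable (fun ω => Real.exp (l * ψ ω)) ν := by
      refine hdom.mono' (hψ.const_mul l).exp.aestronglyMeasurable
        (Filter.Eventually.of_forall fun ω => ?_)
      rw [Real.norm_of_nonneg (Real.exp_pos _).le]
      exact Real.exp_le_add_exp_sq _
    refine lintegral_ofReal_le_of_integral_le hint (fun ω => (Real.exp_pos _).le) ?_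
    refine (integral_mono hint hdom fun ω => Real.exp_le_add_exp_sq _).trans ?_
    rw [integral_add (hi.const_mul l) h1, integral_const_mul, hc]
    linarith
  · obtain ⟨h1, h2⟩ := exp_moment_scale hm h (by norm_num : (0 : ℝ) ≤ 1 / 2) (by norm_num)
    have hle : ∀ ω, Real.exp (l * ψ ω)
        ≤ Real.exp (1 / 2 * (l ^ 2 * v)) * Real.exp (1 / 2 * (ψ ω ^ 2 / v)) := fun ω => by
      rw [← Real.exp_add, Real.exp_le_exp]
      have : 0 ≤ (l * v - ψ ω) ^ 2 / v := by positivity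
      have h3 : (l * v - ψ ω) ^ 2 / v = l ^ 2 * v - 2 * (l * ψ ω) + ψ ω ^ 2 / v := by
        field_simp
        ring
      linarith
    have hint : Integrable (fun ω => Real.exp (l * ψ ω)) ν := by
      refine (h1.const_mul (Real.exp (1 / 2 * (l ^ 2 * v)))).mono' (hψ.const_mul l).exp.aestronglyMeasurable
        (Filter.Eventually.of_forall fun ω => ?_)
      rw [Real.norm_of_nonneg (Real.exp_pos _).le]
      exact hle ω
    refine lintegral_ofReal_le_of_integral_le hint (fun ω => (Real.exp_pos _).le) ?_
    refine (integral_mono hint (h1.const_mul _) hle).trans ?_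
    rw [integral_const_mul]
    calc _ ≤ Real.exp (1 / 2 * (l ^ 2 * v)) * Real.exp (1 / 2) := by gcongr
      _ ≤ Real.exp (l ^ 2 * v) := by
        rw [← Real.exp_add, Real.exp_le_exp]; linarith

end Moments

/-! ## Recursions driven by independent samples -/

section Recursion

variable {T Ω' Γ : Type*} [MeasurableSpace T] [MeasurableSpace Ω'] [MeasurableSpace Γ]
  {μ : Measure T} {ν : Measure Ω'} {ξ : ℕ → T → Ω'} {step : ℕ → Γ × Ω' → Γ}
  {state : ℕ → T → Γ} {s₀ : Γ}

/-- The σ-algebra generated by the samples before time `n`. -/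
abbrev pastSigma (ξ : ℕ → T → Ω') (n : ℕ) : MeasurableSpace T :=
  ⨆ s ∈ Set.Iio n, MeasurableSpace.comap (ξ s) inferInstance

theorem pastSigma_le (hξ : ∀ t, Measurable (ξ t)) (n : ℕ) :
    pastSigma ξ n ≤ ‹MeasurableSpace T› :=
  iSup₂_le fun s _ => (hξ s).comap_le

omit [MeasurableSpace T] in
theorem pastSigma_mono : Monotone (pastSigma ξ) := fun _ _ h =>
  biSup_mono fun _ hs => lt_of_lt_of_le hs h

omit [MeasurableSpace T] in
theorem measurable_sample_pastSigma {s n : ℕ} (h : s < n) : Measurable[pastSigma ξ n] (ξ s) :=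
  measurable_iff_comap_le.2 (le_iSup₂_of_le s h le_rfl)

omit [MeasurableSpace T] in
theorem measurable_state_pastSigma (hstep : ∀ t, Measurable (step t))
    (h0 : ∀ τ, state 0 τ = s₀) (hs : ∀ t τ, state (t + 1) τ = step t (state t τ, ξ t τ)) (n : ℕ) :
    Measurable[pastSigma ξ n] (state n) := by
  induction n with
  | zero =>
    have : state 0 = fun _ => s₀ := funext h0
    rw [this]
    exact measurable_const
  | succ n ih =>
    have : state (n + 1) = fun τ => step n (state n τ, ξ n τ) := funext (hs n)
    rw [this]
    exact (hstep n).comp ((ih.mono (pastSigma_mono n.le_succ) le_rfl).prodMk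
      (measurable_sample_pastSigma n.lt_succ_self))

theorem indepFun_past_sample [IsProbabilityMeasure μ] (hξ : ∀ t, Measurable (ξ t))
    (hindep : iIndepFun ξ μ) {n : ℕ} {β : Type*} [MeasurableSpace β] {g : T → β}
    (hg : Measurable[pastSigma ξ n] g) : IndepFun g (ξ n) μ := by
  have h := indep_iSup_of_disjoint (fun s => (hξ s).comap_le)
    ((iIndepFun_iff_iIndep _ _ _).1 hindep) (S := Set.Iio n) (T := {n}) (by simp)
  rw [IndepFun_iff_Indep]
  refine indep_of_indep_of_le_left (indep_of_indep_of_le_right h ?_)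
    (measurable_iff_comap_le.1 hg)
  exact le_iSup₂_of_le n rfl le_rfl

/-- The last factor is peeled off: the earlier factors and the current state depend on the past, the
new sample does not, so their joint law is a product and Tonelli applies. Uniformity of the one-step
bound in the state replaces conditional expectations. -/
theorem lintegral_prod_le_prod [IsProbabilityMeasure μ] [IsProbabilityMeasure ν]
    (hξ : ∀ t, Measurable (ξ t)) (hindep : iIndepFun ξ μ) (hlaw : ∀ t, μ.map (ξ t) = ν)
    (hstep : ∀ t, Measurable (step t)) (h0 : ∀ τ, state 0 τ = s₀)
    (hs : ∀ t τ, state (t + 1) τ = step t (state t τ, ξ t τ))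
    {W : ℕ → Γ × Ω' → ENNReal} {C : ℕ → ENNReal} (hW : ∀ t, Measurable (W t))
    (hC : ∀ t x, ∫⁻ ω, W t (x, ω) ∂ν ≤ C t) (n : ℕ) :
    ∫⁻ τ, ∏ s ∈ Finset.range n, W s (state s τ, ξ s τ) ∂μ ≤ ∏ s ∈ Finset.range n, C s := by
  induction n with
  | zero => simp
  | succ n ih =>
    have hst := fun k => measurable_state_pastSigma (ξ := ξ) hstep h0 hs k
    set f : T → ENNReal := fun τ => ∏ s ∈ Finset.range n, W s (state s τ, ξ s τ) with hf
    have hfm : Measurable[pastSigma ξ n] f := by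
      refine Finset.measurable_prod _ fun s hsn => (hW s).comp ?_
      have hsn' := Finset.mem_range.1 hsn
      exact ((hst s).mono (pastSigma_mono hsn'.le) le_rfl).prodMk
        (measurable_sample_pastSigma hsn')
    have hpair : Measurable[pastSigma ξ n] fun τ => (f τ, state n τ) := hfm.prodMk (hst n)
    have hpair' : Measurable fun τ => (f τ, state n τ) := hpair.mono (pastSigma_le hξ n) le_rfl
    have hmap := (indepFun_iff_map_prod_eq_prod_map_map hpair'.aemeasurable
      (hξ n).aemeasurable).1 (indepFun_past_sample hξ hindep hpair)
    have hg : Measurable fun p : (ENNReal × Γ) × Ω' => p.1.1 * W n (p.1.2, p.2) :=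
      (measurable_fst.comp measurable_fst).mul ((hW n).comp
        ((measurable_snd.comp measurable_fst).prodMk measurable_snd))
    calc ∫⁻ τ, ∏ s ∈ Finset.range (n + 1), W s (state s τ, ξ s τ) ∂μ
        = ∫⁻ τ, f τ * W n (state n τ, ξ n τ) ∂μ := by
          simp only [Finset.prod_range_succ, hf]
      _ = ∫⁻ p, p.1.1 * W n (p.1.2, p.2) ∂(μ.map fun τ => ((f τ, state n τ), ξ n τ)) := by
          rw [lintegral_map hg (hpair'.prodMk (hξ n))]
      _ = ∫⁻ a, ∫⁻ ω, a.1 * W n (a.2, ω) ∂ν ∂(μ.map fun τ => (f τ, state n τ)) := by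
          rw [hmap, hlaw, lintegral_prod _ hg.aemeasurable]
      _ ≤ ∫⁻ a, a.1 * C n ∂(μ.map fun τ => (f τ, state n τ)) := by
          refine lintegral_mono fun a => ?_
          rw [lintegral_const_mul a.1 (f := fun ω => W n (a.2, ω))
            ((hW n).comp measurable_prodMk_left)]
          gcongr
          exact hC n a.2
      _ = (∫⁻ τ, f τ ∂μ) * C n := by
          rw [lintegral_map (measurable_fst.mul_const _) hpair']
          exact lintegral_mul_const _ (hfm.mono (pastSigma_le hξ n) le_rfl)
      _ ≤ _ := by
          rw [Finset.prod_range_succ]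
          gcongr

/-- Chernoff's bound along a recursion driven by independent samples. -/
theorem measure_sum_ge_le [IsProbabilityMeasure μ] [IsProbabilityMeasure ν]
    (hξ : ∀ t, Measurable (ξ t)) (hindep : iIndepFun ξ μ) (hlaw : ∀ t, μ.map (ξ t) = ν)
    (hstep : ∀ t, Measurable (step t)) (h0 : ∀ τ, state 0 τ = s₀)
    (hs : ∀ t τ, state (t + 1) τ = step t (state t τ, ξ t τ))
    {h : ℕ → Γ × Ω' → ℝ} {c : ℕ → ℝ} (hh : ∀ t, Measurable (h t))
    (hc : ∀ t x, ∫⁻ ω, ENNReal.ofReal (Real.exp (h t (x, ω))) ∂ν ≤ ENNReal.ofReal (Real.exp (c t)))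
    (n : ℕ) (l : ℝ) :
    MeasurableSet {τ | ∑ s ∈ Finset.range n, c s + l
      ≤ ∑ s ∈ Finset.range n, h s (state s τ, ξ s τ)} ∧
    μ {τ | ∑ s ∈ Finset.range n, c s + l ≤ ∑ s ∈ Finset.range n, h s (state s τ, ξ s τ)}
      ≤ ENNReal.ofReal (Real.exp (-l)) := by
  have hsm : ∀ s, Measurable (state s) := fun s =>
    (measurable_state_pastSigma (ξ := ξ) hstep h0 hs s).mono (pastSigma_le hξ s) le_rfl
  have hm : Measurable fun τ => ∑ s ∈ Finset.range n, h s (state s τ, ξ s τ) :=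
    Finset.measurable_sum _ fun s _ => (hh s).comp ((hsm s).prodMk (hξ s))
  refine ⟨measurableSet_le measurable_const hm, ?_⟩
  have h1 := lintegral_prod_le_prod hξ hindep hlaw hstep h0 hs
    (fun t => (hh t).exp.ennreal_ofReal) hc n
  rw [← ENNReal.ofReal_prod_of_nonneg (fun _ _ => (Real.exp_pos _).le), ← Real.exp_sum] at h1
  have h2 : ∀ τ, ∏ s ∈ Finset.range n, ENNReal.ofReal (Real.exp (h s (state s τ, ξ s τ)))
      = ENNReal.ofReal (Real.exp (∑ s ∈ Finset.range n, h s (state s τ, ξ s τ))) := fun τ => by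
    rw [← ENNReal.ofReal_prod_of_nonneg (fun _ _ => (Real.exp_pos _).le), ← Real.exp_sum]
  simp only [h2] at h1
  have h3 := mul_meas_ge_le_lintegral (μ := μ) hm.exp.ennreal_ofReal
    (ENNReal.ofReal (Real.exp (∑ s ∈ Finset.range n, c s + l)))
  have h4 : {τ | ENNReal.ofReal (Real.exp (∑ s ∈ Finset.range n, c s + l))
      ≤ ENNReal.ofReal (Real.exp (∑ s ∈ Finset.range n, h s (state s τ, ξ s τ)))}
      = {τ | ∑ s ∈ Finset.range n, c s + l
        ≤ ∑ s ∈ Finset.range n, h s (state s τ, ξ s τ)} := by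
    ext τ
    simp only [Set.mem_ofPred_eq, ENNReal.ofReal_le_ofReal_iff (Real.exp_pos _).le,
      Real.exp_le_exp]
  rw [h4] at h3
  have h5 := h3.trans h1
  rw [Real.exp_add, ENNReal.ofReal_mul (Real.exp_pos _).le, mul_assoc] at h5
  have hne : ENNReal.ofReal (Real.exp (∑ s ∈ Finset.range n, c s)) ≠ 0 := by
    simp [Real.exp_pos]
  have h6 : ENNReal.ofReal (Real.exp l) * μ {τ | ∑ s ∈ Finset.range n, c s + l
      ≤ ∑ s ∈ Finset.range n, h s (state s τ, ξ s τ)} ≤ 1 := by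
    rw [← ENNReal.mul_le_mul_iff_right hne ENNReal.ofReal_ne_top, mul_one]
    exact h5
  rw [Real.exp_neg, ENNReal.ofReal_inv_of_pos (Real.exp_pos _), ENNReal.le_inv_iff_mul_le]
  rwa [mul_comm]

end Recursion

/-! ## Stochastic mirror descent with a regret bound uniform over the feasible set -/

theorem one_sub_le_measure_compl_union {T : Type*} [MeasurableSpace T] {μ : Measure T}
    [IsProbabilityMeasure μ] {A B : Set T} (hA : MeasurableSet A) (hB : MeasurableSet B) {p : ℝ}
    (hp : 0 ≤ p) (hAp : μ A ≤ ENNReal.ofReal p) (hBp : μ B ≤ ENNReal.ofReal p) :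
    ENNReal.ofReal (1 - 2 * p) ≤ μ (A ∪ B)ᶜ := by
  rw [prob_compl_eq_one_sub (hA.union hB)]
  have h : μ (A ∪ B) ≤ ENNReal.ofReal (2 * p) := by
    rw [two_mul, ENNReal.ofReal_add hp hp]
    exact (measure_union_le A B).trans (add_le_add hAp hBp)
  rw [ENNReal.ofReal_sub _ (by positivity), ENNReal.ofReal_one]
  exact tsub_le_tsub_left h 1

/-- The noise of a light-tailed stochastic subgradient, in a bounded direction, is sub-Gaussian. -/
theorem IsProxSetup.exp_moment_noise {E : Type*} [NormedAddCommGroup E] [NormedSpace ℝ E]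
    [FiniteDimensional ℝ E] {K : Set E} {ω : E → ℝ}
    {dω : E → (E →L[ℝ] ℝ)} {Q : E → ℝ} {q : (E →L[ℝ] ℝ) → ℝ} (S : IsProxSetup K ω dω Q q)
    {Ω' : Type*} [MeasurableSpace Ω'] {ν : Measure Ω'} [IsProbabilityMeasure ν]
    {G : Ω' → (E →L[ℝ] ℝ)} (hGm : Measurable G) (hGi : Integrable G ν) {M : ℝ} (hM : 0 < M)
    (hlt : ∫⁻ o, ENNReal.ofReal (Real.exp (q (G o) / M ^ 2)) ∂ν ≤ ENNReal.ofReal (Real.exp 1))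
    (hgq : q (∫ o, G o ∂ν) ≤ M ^ 2) {w : E} (hw : ∀ ζ : E →L[ℝ] ℝ, (ζ w) ^ 2 ≤ 8 * q ζ) (l : ℝ) :
    ∫⁻ o, ENNReal.ofReal (Real.exp (l * ((G o - ∫ o, G o ∂ν) w / M))) ∂ν
      ≤ ENNReal.ofReal (Real.exp (l ^ 2 * 32)) := by
  generalize hg : ∫ o, G o ∂ν = g at *
  have hi : Integrable (fun o => G o w) ν := hGi.apply_continuousLinearMap w
  have hgw : ∫ o, G o w ∂ν = g w := by
    rw [← ContinuousLinearMap.integral_apply hGi, hg]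
  have hm : Measurable fun o => G o w :=
    (ContinuousLinearMap.apply ℝ ℝ w).continuous.measurable.comp hGm
  have hXm : Measurable fun o => q (G o) / M ^ 2 := (S.q_continuous.measurable.comp hGm).div_const _
  refine exp_moment_of_centred (ψ := fun o => (G o - g) w / M) (v := 32) ?_ ?_ ?_
    (by norm_num) ?_ l
  · simp only [sub_apply]
    exact (hm.sub_const _).div_const M
  · simp only [sub_apply]
    exact (hi.sub (integrable_const _)).div_const M
  · simp only [sub_apply]
    rw [integral_div, integral_sub hi (integrable_const _), hgw]
    simp
  · obtain ⟨i1, i2⟩ := exp_moment_scale hXm hlt (a := 1 / 2) (by positivity) (by norm_num)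
    -- The constant `32` is twice `16`: from `(ζ w)² ≤ 8 q(ζ)` and `q(G - g) ≤ 2q(G) + 2M²`, the
    -- square is at most `16 q(G)/M² + 16`. Dividing by `32` leaves two halves, each contributing
    -- `exp(1/2)`.
    have hle : ∀ o, Real.exp (((G o - g) w / M) ^ 2 / 32)
        ≤ Real.exp (1 / 2) * Real.exp (1 / 2 * (q (G o) / M ^ 2)) := fun o => by
      rw [← Real.exp_add, Real.exp_le_exp]
      have h1 := hw (G o - g)
      have h2 := S.q_sub_le (G o) g
      have h3 : ((G o - g) w / M) ^ 2 ≤ 16 * (q (G o) / M ^ 2) + 16 := by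
        rw [div_pow, div_le_iff₀ (by positivity), add_mul, mul_assoc, div_mul_cancel₀ _
          (by positivity)]
        linarith
      linarith
    refine (lintegral_mono fun o => ENNReal.ofReal_le_ofReal (hle o)).trans
      (lintegral_ofReal_le_of_integral_le (i1.const_mul _) (fun _ => by positivity) ?_)
    rw [integral_const_mul]
    calc _ ≤ Real.exp (1 / 2) * Real.exp (1 / 2) := by gcongr
      _ = Real.exp 1 := by rw [← Real.exp_add]; norm_num

/-- The event is chosen before `u`, because the auxiliary descent absorbs the dependence of `u` on
the noise. With `h` the harmonic sum and `R = √(32hL)`, the two regrets contribute `1 + ½(h + L)`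
and `1 + (h + L) + h`, and the martingale `2R`. -/
theorem IsProxSetup.exists_event_regret_le {E : Type*} [NormedAddCommGroup E] [NormedSpace ℝ E]
    [FiniteDimensional ℝ E] [MeasurableSpace E] [BorelSpace E] {K : Set E} {ω : E → ℝ}
    {dω : E → (E →L[ℝ] ℝ)} {Q : E → ℝ} {q : (E →L[ℝ] ℝ) → ℝ} (S : IsProxSetup K ω dω Q q)
    (hdiam : ∀ u ∈ K, ∀ v ∈ K, ω u - ω v ≤ 1)
    {T Ω' : Type*} [MeasurableSpace T] [MeasurableSpace Ω'] {μ : Measure T}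
    [IsProbabilityMeasure μ] {ν : Measure Ω'} [IsProbabilityMeasure ν] {ξ : ℕ → T → Ω'}
    (hξ : ∀ t, Measurable (ξ t)) (hindep : iIndepFun ξ μ) (hlaw : ∀ t, μ.map (ξ t) = ν)
    {Gs : E → Ω' → (E →L[ℝ] ℝ)}
    (hGm : Measurable fun p : (E →L[ℝ] ℝ) × Ω' => Gs (proxPoint K ω p.1) p.2)
    (hGi : ∀ z ∈ K, Integrable (Gs z) ν) {M : ℝ} (hM : 0 < M)
    (hlt : ∀ z ∈ K, ∫⁻ o, ENNReal.ofReal (Real.exp (q (Gs z o) / M ^ 2)) ∂ν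
      ≤ ENNReal.ofReal (Real.exp 1))
    (hgq : ∀ z ∈ K, q (∫ o, Gs z o ∂ν) ≤ M ^ 2)
    {η : ℕ → T → (E →L[ℝ] ℝ)} (h0 : ∀ τ, η 0 τ = 0)
    (hη : ∀ t τ, η (t + 1) τ = SMD.stepLength M t • Gs (proxPoint K ω (η t τ)) (ξ t τ)
      - dω (proxPoint K ω (η t τ)))
    {L : ℝ} (hL : 0 < L) {n : ℕ} (hn : 0 < n) :
    ∃ A : Set T, MeasurableSet A ∧ ENNReal.ofReal (1 - 2 * Real.exp (-L)) ≤ μ A ∧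
      ∀ τ ∈ A, ∀ u ∈ K,
        ∑ s ∈ Finset.range n, SMD.stepLength M s *
            (∫ o, Gs (proxPoint K ω (η s τ)) o ∂ν) (proxPoint K ω (η s τ) - u)
          ≤ 2 + 5 / 2 * ∑ s ∈ Finset.range n, 1 / ((s : ℝ) + 1) + 3 / 2 * L
            + 2 * √(32 * (∑ s ∈ Finset.range n, 1 / ((s : ℝ) + 1)) * L) := by
  have : ProperSpace E := FiniteDimensional.proper_real E
  have : SecondCountableTopology E := secondCountable_of_proper
  set γ := SMD.stepLength M with hγ
  set P : (E →L[ℝ] ℝ) → E := proxPoint K ω with hP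
  set g : E → (E →L[ℝ] ℝ) := fun z => ∫ o, Gs z o ∂ν with hg
  set h : ℝ := ∑ s ∈ Finset.range n, 1 / ((s : ℝ) + 1) with hh
  have hPK : ∀ x, P x ∈ K := S.proxPoint_mem
  have hPm : Measurable P := S.continuous_proxPoint.measurable
  have hdm : Measurable fun x => dω (P x) := S.continuous_derivative_proxPoint.measurable
  have hgm : Measurable fun x => g (P x) := by
    have := hGm.stronglyMeasurable.integral_prod_right' (ν := ν)
    exact this.measurable
  have hγ2 : ∀ s, γ s ^ 2 * M ^ 2 = 1 / ((s : ℝ) + 1) := fun s => by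
    have h1 : (0 : ℝ) < (s : ℝ) + 1 := by positivity
    have h2 : √((s : ℝ) + 1) ^ 2 = (s : ℝ) + 1 := Real.sq_sqrt h1.le
    simp only [hγ, SMD.stepLength, div_pow, mul_pow, h2]
    field_simp
  -- the iterates together with those of the auxiliary sequence driven by the noise
  set Δ : (E →L[ℝ] ℝ) × Ω' → (E →L[ℝ] ℝ) := fun p => Gs (P p.1) p.2 - g (P p.1) with hΔ
  have hΔm : Measurable Δ := hGm.sub (hgm.comp measurable_fst)
  set step : ℕ → ((E →L[ℝ] ℝ) × (E →L[ℝ] ℝ)) × Ω' → (E →L[ℝ] ℝ) × (E →L[ℝ] ℝ) := fun s p =>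
    (γ s • Gs (P p.1.1) p.2 - dω (P p.1.1), -γ s • Δ (p.1.1, p.2) - dω (P p.1.2)) with hstep
  have hm1 : Measurable fun p : ((E →L[ℝ] ℝ) × (E →L[ℝ] ℝ)) × Ω' => (p.1.1, p.2) :=
    (measurable_fst.comp measurable_fst).prodMk measurable_snd
  have hm2 : Measurable fun p : ((E →L[ℝ] ℝ) × (E →L[ℝ] ℝ)) × Ω' => p.1.2 := measurable_snd.comp measurable_fst
  have hG' : Measurable fun p : ((E →L[ℝ] ℝ) × (E →L[ℝ] ℝ)) × Ω' => Gs (P p.1.1) p.2 := hGm.comp hm1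
  have hstepm : ∀ s, Measurable (step s) := fun s =>
    ((hG'.const_smul (γ s)).sub (hdm.comp (measurable_fst.comp measurable_fst))).prodMk
      (((hΔm.comp hm1).const_smul (-γ s)).sub (hdm.comp hm2))
  let state : ℕ → T → (E →L[ℝ] ℝ) × (E →L[ℝ] ℝ) := fun t τ =>
    Nat.rec (0, 0) (fun s x => step s (x, ξ s τ)) t
  have hs0 : ∀ τ, state 0 τ = (0, 0) := fun τ => rfl
  have hss : ∀ t τ, state (t + 1) τ = step t (state t τ, ξ t τ) := fun t τ => rfl
  have hfst : ∀ t τ, (state t τ).1 = η t τ := by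
    intro t τ
    induction t with
    | zero => rw [hs0, h0]
    | succ t ih => rw [hss, hη, ← ih]
  -- the squared norms of the stochastic subgradients
  set X : (E →L[ℝ] ℝ) × Ω' → ℝ := fun p => q (Gs (P p.1) p.2) / M ^ 2 with hX
  have hXm : Measurable X := (S.q_continuous.measurable.comp hGm).div_const _
  have hXm' : ∀ x, Measurable fun o => X (x, o) := fun x => hXm.comp measurable_prodMk_left
  obtain ⟨hA1, hA2⟩ := measure_sum_ge_le hξ hindep hlaw hstepm hs0 hss
    (h := fun s p => 1 / ((s : ℝ) + 1) * X (p.1.1, p.2)) (c := fun s => 1 / ((s : ℝ) + 1))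
    (fun s => (hXm.comp hm1).const_mul _)
    (fun s x => by
      have hs : (0 : ℝ) < (s : ℝ) + 1 := by positivity
      obtain ⟨i1, i2⟩ := exp_moment_scale (hXm' x.1) (hlt _ (hPK x.1))
        (a := 1 / ((s : ℝ) + 1)) (by positivity) (by rw [div_le_one hs]; simp)
      exact lintegral_ofReal_le_of_integral_le i1 (fun _ => (Real.exp_pos _).le) i2) n L
  -- the martingale part
  set ψ : ((E →L[ℝ] ℝ) × (E →L[ℝ] ℝ)) × Ω' → ℝ := fun p => Δ (p.1.1, p.2) (P p.1.2 - P p.1.1) / M with hψ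
  have hψm : Measurable ψ := by
    refine Measurable.div_const ?_ M
    exact (isBoundedBilinearMap_apply (𝕜 := ℝ) (E := E) (F := ℝ)).continuous.measurable.comp
      ((hΔm.comp hm1).prodMk ((hPm.comp hm2).sub (hPm.comp (measurable_fst.comp measurable_fst))))
  have hqΔ : ∀ p, q (Δ p) ≤ M ^ 2 * (2 * X p + 2) := fun p => by
    have h1 := S.q_sub_le (Gs (P p.1) p.2) (g (P p.1))
    have h2 := hgq _ (hPK p.1)
    have h3 : M ^ 2 * X p = q (Gs (P p.1) p.2) := by
      simp only [hX]; field_simp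
    simp only [hΔ]
    linarith
  have hψsg : ∀ x l, ∫⁻ o, ENNReal.ofReal (Real.exp (l * ψ (x, o))) ∂ν
      ≤ ENNReal.ofReal (Real.exp (l ^ 2 * 32)) :=
    fun x l => S.exp_moment_noise (hGm.comp measurable_prodMk_left) (hGi _ (hPK x.1)) hM
      (hlt _ (hPK x.1)) (hgq _ (hPK x.1))
      (fun ζ => S.sq_pairing_sub_le hdiam ζ (hPK x.2) (hPK x.1)) l
  have hhpos : 0 < h := Finset.sum_pos (fun s _ => by positivity)
    (Finset.nonempty_range_iff.2 hn.ne')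
  set R : ℝ := √(32 * h * L) with hR
  have hRpos : 0 < R := Real.sqrt_pos.2 (by positivity)
  have hR2 : R ^ 2 = 32 * h * L := Real.sq_sqrt (by positivity)
  have hlR : L / R > 0 := by positivity
  -- This choice balances the Chernoff exponent: `32 l² h = L`, so the martingale is below `2L / l =
  -- 2R` off the bad event.
  set l := L / R with hl
  have hb2 : ∀ s : ℕ, (γ s * M) ^ 2 = 1 / ((s : ℝ) + 1) := fun s => by rw [mul_pow, hγ2]
  obtain ⟨hB1, hB2⟩ := measure_sum_ge_le hξ hindep hlaw hstepm hs0 hss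
    (h := fun s p => l * (γ s * M) * ψ p) (c := fun s => l ^ 2 * 32 * (1 / ((s : ℝ) + 1)))
    (fun s => hψm.const_mul _)
    (fun s x => by
      have := hψsg x (l * (γ s * M))
      rwa [mul_pow, hb2, mul_right_comm] at this) n L
  refine ⟨_, (hA1.union hB1).compl,
    one_sub_le_measure_compl_union hA1 hB1 (Real.exp_pos _).le hA2 hB2, fun τ hτ u hu => ?_⟩
  have hτA : ∑ s ∈ Finset.range n, 1 / ((s : ℝ) + 1) * X ((state s τ).1, ξ s τ) < h + L :=
    not_le.1 fun hc => hτ (Or.inl hc)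
  have hτB : ∑ s ∈ Finset.range n, l * (γ s * M) * ψ (state s τ, ξ s τ)
      < ∑ s ∈ Finset.range n, l ^ 2 * 32 * (1 / ((s : ℝ) + 1)) + L :=
    not_le.1 fun hc => hτ (Or.inr hc)
  have hnoise : ∑ s ∈ Finset.range n, γ s * M * ψ (state s τ, ξ s τ) ≤ 2 * R := by
    simp only [mul_assoc l] at hτB
    rw [← Finset.mul_sum, ← Finset.mul_sum, ← hh] at hτB
    have h1 : l ^ 2 * 32 * h = L := by
      rw [hl, div_pow, hR2]; field_simp
    rw [h1] at hτB
    have h2 : L + L = l * (2 * R) := by rw [hl]; field_simp; ring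
    rw [h2] at hτB
    exact (lt_of_mul_lt_mul_left hτB hlR.le).le
  have hreg1 := S.sum_pairing_le hdiam
    (fun s => γ s • Gs (P (state s τ).1) (ξ s τ)) (fun s => (state s τ).1) rfl
    (fun t => rfl) n hu
  have hreg2 := S.sum_pairing_le hdiam
    (fun s => -γ s • Δ ((state s τ).1, ξ s τ)) (fun s => (state s τ).2) rfl
    (fun t => rfl) n hu
  have hq1 : ∑ s ∈ Finset.range n, q (γ s • Gs (P (state s τ).1) (ξ s τ)) ≤ h + L := by
    refine le_trans (Finset.sum_le_sum fun s _ => le_of_eq ?_) hτA.le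
    rw [S.q_smul, ← hγ2]
    simp only [hX]
    field_simp
  have hq2 : ∑ s ∈ Finset.range n, q (-γ s • Δ ((state s τ).1, ξ s τ))
      ≤ 2 * (h + L) + 2 * h := by
    have h1 : ∑ s ∈ Finset.range n, q (-γ s • Δ ((state s τ).1, ξ s τ))
        ≤ ∑ s ∈ Finset.range n, (2 * (1 / ((s : ℝ) + 1) * X ((state s τ).1, ξ s τ))
          + 2 * (1 / ((s : ℝ) + 1))) := by
      refine Finset.sum_le_sum fun s _ => ?_
      rw [S.q_smul, ← hγ2, neg_sq]
      have := mul_le_mul_of_nonneg_left (hqΔ ((state s τ).1, ξ s τ)) (sq_nonneg (γ s))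
      linarith
    rw [Finset.sum_add_distrib, ← Finset.mul_sum, ← Finset.mul_sum, ← hh] at h1
    linarith
  -- Substitute `g = G - Δ` and insert the auxiliary iterate `v`: `-Δ(z - u) = -Δ(v - u) + Δ(v -
  -- z)`.
  have hsplit : ∑ s ∈ Finset.range n, γ s * g (P (η s τ)) (P (η s τ) - u)
      = ∑ s ∈ Finset.range n, (γ s • Gs (P (state s τ).1) (ξ s τ)) (P (state s τ).1 - u)
        + ∑ s ∈ Finset.range n, (-γ s • Δ ((state s τ).1, ξ s τ)) (P (state s τ).2 - u)
        + ∑ s ∈ Finset.range n, γ s * M * ψ (state s τ, ξ s τ) := by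
    rw [← Finset.sum_add_distrib, ← Finset.sum_add_distrib]
    refine Finset.sum_congr rfl fun s _ => ?_
    rw [hfst]
    simp only [hψ, hΔ, smul_apply, sub_apply, smul_eq_mul, map_sub, hfst]
    field_simp
    ring
  rw [hsplit]
  linarith

/-! ## Norms and dual norms on `ℝⁿ` -/

namespace SMD

section DualNorm

variable {n : ℕ} {p : Seminorm ℝ (Fin n → ℝ)}

theorem continuous_seminorm (p : Seminorm ℝ (Fin n → ℝ)) : Continuous p :=
  p.convexOn.locallyLipschitz.continuous

theorem exists_norm_le_seminorm (hp : ∀ v, p v = 0 → v = 0) :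
    ∃ c > 0, ∀ v, c * ‖v‖ ≤ p v := by
  -- The sphere is empty when `n = 0`, where any constant serves; otherwise the minimum of `p` on it
  -- does.
  rcases (Metric.sphere (0 : Fin n → ℝ) 1).eq_empty_or_nonempty with h | h
  · refine ⟨1, one_pos, fun v => ?_⟩
    by_cases hv : v = 0
    · simp [hv]
    · exfalso
      have : ‖v‖⁻¹ • v ∈ Metric.sphere (0 : Fin n → ℝ) 1 := by
        simp [norm_smul, norm_ne_zero_iff.2 hv]
      simp [h] at this
  · obtain ⟨w, hw, hmin⟩ := (isCompact_sphere (0 : Fin n → ℝ) 1).exists_isMinOn h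
      (continuous_seminorm p).continuousOn
    have hw1 : ‖w‖ = 1 := by simpa using hw
    have hw0 : w ≠ 0 := by rintro rfl; simp at hw1
    refine ⟨p w, lt_of_le_of_ne (apply_nonneg p w) fun h0 => hw0 (hp w h0.symm), fun v => ?_⟩
    by_cases hv : v = 0
    · simp [hv]
    · have hnv : 0 < ‖v‖ := norm_pos_iff.2 hv
      have hmem : ‖v‖⁻¹ • v ∈ Metric.sphere (0 : Fin n → ℝ) 1 := by
        simp [norm_smul, norm_ne_zero_iff.2 hv]
      have h1 : p w ≤ p (‖v‖⁻¹ • v) := hmin hmem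
      rw [map_smul_eq_mul, Real.norm_of_nonneg (by positivity), inv_mul_eq_div,
        le_div_iff₀ hnv] at h1
      exact h1

theorem abs_dotProduct_le (ζ v : Fin n → ℝ) : |ζ ⬝ᵥ v| ≤ (∑ i, |ζ i|) * ‖v‖ := by
  rw [dotProduct, Finset.sum_mul]
  refine (Finset.abs_sum_le_sum_abs _ _).trans (Finset.sum_le_sum fun i _ => ?_)
  rw [abs_mul]
  gcongr
  exact norm_le_pi_norm v i

theorem dualNorm_bddAbove (hp : ∀ v, p v = 0 → v = 0) (ζ : Fin n → ℝ) :
    BddAbove {c : ℝ | ∃ v : Fin n → ℝ, p v ≤ 1 ∧ c = ζ ⬝ᵥ v} := by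
  obtain ⟨c, hc, h⟩ := exists_norm_le_seminorm hp
  refine ⟨(∑ i, |ζ i|) * c⁻¹, ?_⟩
  rintro _ ⟨v, hv, rfl⟩
  refine (le_abs_self _).trans ((abs_dotProduct_le ζ v).trans ?_)
  gcongr
  rw [← one_div, le_div_iff₀ hc]
  linarith [h v]

theorem dotProduct_le_dualNorm_of_le_one (hp : ∀ v, p v = 0 → v = 0) (ζ : Fin n → ℝ)
    {v : Fin n → ℝ} (hv : p v ≤ 1) : ζ ⬝ᵥ v ≤ dualNorm p ζ :=
  le_csSup (dualNorm_bddAbove hp ζ) ⟨v, hv, rfl⟩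

theorem dualNorm_le {ζ : Fin n → ℝ} {b : ℝ} (h : ∀ v, p v ≤ 1 → ζ ⬝ᵥ v ≤ b) :
    dualNorm p ζ ≤ b := by
  refine csSup_le ⟨0, 0, by simp, by simp⟩ ?_
  rintro _ ⟨v, hv, rfl⟩
  exact h v hv

theorem dualNorm_nonneg (hp : ∀ v, p v = 0 → v = 0) (ζ : Fin n → ℝ) : 0 ≤ dualNorm p ζ := by
  simpa using dotProduct_le_dualNorm_of_le_one hp ζ (v := 0) (by simp)

theorem dotProduct_le_dualNorm_mul (hp : ∀ v, p v = 0 → v = 0) (ζ v : Fin n → ℝ) :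
    ζ ⬝ᵥ v ≤ dualNorm p ζ * p v := by
  by_cases hv : v = 0
  · simp [hv]
  · have hpv : 0 < p v := lt_of_le_of_ne (apply_nonneg p v) fun h => hv (hp v h.symm)
    have h := dotProduct_le_dualNorm_of_le_one hp ζ (v := (p v)⁻¹ • v) (by
      rw [map_smul_eq_mul, Real.norm_of_nonneg (by positivity), inv_mul_cancel₀ hpv.ne'])
    rw [dotProduct_smul, smul_eq_mul, inv_mul_eq_div, div_le_iff₀ hpv] at h
    exact h

theorem abs_dotProduct_le_dualNorm_mul (hp : ∀ v, p v = 0 → v = 0) (ζ v : Fin n → ℝ) :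
    |ζ ⬝ᵥ v| ≤ dualNorm p ζ * p v := by
  refine abs_le'.2 ⟨dotProduct_le_dualNorm_mul hp ζ v, ?_⟩
  simpa using dotProduct_le_dualNorm_mul hp ζ (-v)

theorem dualNorm_add_le (hp : ∀ v, p v = 0 → v = 0) (ζ ζ' : Fin n → ℝ) :
    dualNorm p (ζ + ζ') ≤ dualNorm p ζ + dualNorm p ζ' :=
  dualNorm_le fun v hv => by
    rw [add_dotProduct]
    exact add_le_add (dotProduct_le_dualNorm_of_le_one hp ζ hv)
      (dotProduct_le_dualNorm_of_le_one hp ζ' hv)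

theorem dualNorm_smul_le (hp : ∀ v, p v = 0 → v = 0) (c : ℝ) (ζ : Fin n → ℝ) :
    dualNorm p (c • ζ) ≤ ‖c‖ * dualNorm p ζ :=
  dualNorm_le fun v hv => by
    rw [smul_dotProduct, smul_eq_mul]
    refine (le_abs_self _).trans ?_
    rw [abs_mul, Real.norm_eq_abs]
    gcongr
    refine (abs_dotProduct_le_dualNorm_mul hp ζ v).trans ?_
    exact mul_le_of_le_one_right (dualNorm_nonneg hp ζ) hv

/-- The dual norm as a seminorm. -/
noncomputable def dualSeminorm (p : Seminorm ℝ (Fin n → ℝ)) (hp : ∀ v, p v = 0 → v = 0) :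
    Seminorm ℝ (Fin n → ℝ) :=
  Seminorm.ofSMulLE (dualNorm p)
    (le_antisymm (dualNorm_le fun v _ => by simp) (dualNorm_nonneg hp 0))
    (dualNorm_add_le hp) (dualNorm_smul_le hp)

theorem dualSeminorm_apply (hp : ∀ v, p v = 0 → v = 0) (ζ : Fin n → ℝ) :
    dualSeminorm p hp ζ = dualNorm p ζ := rfl

theorem continuous_dualNorm (hp : ∀ v, p v = 0 → v = 0) : Continuous (dualNorm p) :=
  continuous_seminorm (dualSeminorm p hp)

theorem dualNorm_smul (hp : ∀ v, p v = 0 → v = 0) (c : ℝ) (ζ : Fin n → ℝ) :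
    dualNorm p (c • ζ) = |c| * dualNorm p ζ := by
  simpa [dualSeminorm_apply] using map_smul_eq_mul (dualSeminorm p hp) c ζ

theorem dualNorm_sub_le (hp : ∀ v, p v = 0 → v = 0) (ζ ζ' : Fin n → ℝ) :
    dualNorm p (ζ - ζ') ≤ dualNorm p ζ + dualNorm p ζ' := by
  simpa [dualSeminorm_apply] using map_sub_le_add (dualSeminorm p hp) ζ ζ'

/-- The dual norm is definite, as pairing `ζ` with itself shows, so the comparison available for any
norm applies to it. -/
theorem exists_norm_le_dualNorm (hp : ∀ v, p v = 0 → v = 0) :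
    ∃ c > 0, ∀ ζ, c * ‖ζ‖ ≤ dualNorm p ζ := by
  refine exists_norm_le_seminorm (p := dualSeminorm p hp) fun ζ h => ?_
  rw [dualSeminorm_apply] at h
  have h1 := dotProduct_le_dualNorm_mul hp ζ ζ
  rw [h, zero_mul] at h1
  exact dotProduct_self_eq_zero.1 (le_antisymm h1 (Finset.sum_nonneg fun i _ => mul_self_nonneg _))

end DualNorm

/-! ## Light-tailed vectors -/

section LightTails

variable {n : ℕ} {p : Seminorm ℝ (Fin n → ℝ)} {Ω' : Type*} [MeasurableSpace Ω'] {ν : Measure Ω'}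
  [IsProbabilityMeasure ν] {G : Ω' → Fin n → ℝ} {c : ℝ}

theorem integrable_of_lightTail (hp : ∀ v, p v = 0 → v = 0) (hG : Measurable G) (hc : 0 < c)
    (h : ∫⁻ o, ENNReal.ofReal (Real.exp (dualNorm p (G o) ^ 2 / c ^ 2)) ∂ν
      ≤ ENNReal.ofReal (Real.exp 1)) : Integrable G ν := by
  obtain ⟨b, hb, hle⟩ := exists_norm_le_dualNorm hp
  have hm : Measurable fun o => dualNorm p (G o) ^ 2 / c ^ 2 :=
    (((continuous_dualNorm hp).measurable.comp hG).pow_const 2).div_const _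
  have hi := integrable_of_exp_moment hm (fun o => by positivity) h
  refine (((hi.const_mul (c / 2)).add (integrable_const (c / 2))).const_mul b⁻¹).mono'
    hG.aestronglyMeasurable (Filter.Eventually.of_forall fun o => ?_)
  show ‖G o‖ ≤ b⁻¹ * (c / 2 * (dualNorm p (G o) ^ 2 / c ^ 2) + c / 2)
  rw [inv_mul_eq_div, le_div_iff₀ hb]
  have h1 : c / 2 * (dualNorm p (G o) ^ 2 / c ^ 2) + c / 2 - dualNorm p (G o)
      = (dualNorm p (G o) - c) ^ 2 / (2 * c) := by
    field_simp
    ring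
  have h2 : 0 ≤ (dualNorm p (G o) - c) ^ 2 / (2 * c) := by positivity
  linarith [hle (G o)]

/-- Integrate `‖G‖_* ≤ (c/2) ‖G‖_*²/c² + c/2` against a fixed unit direction; the light tail gives
`𝔼[‖G‖_*²/c²] ≤ 1`. -/
theorem dualNorm_integral_le (hp : ∀ v, p v = 0 → v = 0) (hG : Measurable G) (hc : 0 < c)
    (h : ∫⁻ o, ENNReal.ofReal (Real.exp (dualNorm p (G o) ^ 2 / c ^ 2)) ∂ν
      ≤ ENNReal.ofReal (Real.exp 1)) : dualNorm p (fun i => ∫ o, G o i ∂ν) ≤ c := by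
  have hGi := integrable_of_lightTail hp hG hc h
  have hm : Measurable fun o => dualNorm p (G o) ^ 2 / c ^ 2 :=
    (((continuous_dualNorm hp).measurable.comp hG).pow_const 2).div_const _
  have hi := integrable_of_exp_moment hm (fun o => by positivity) h
  have hone := integral_le_one_of_exp_moment hm (fun o => by positivity) h
  refine dualNorm_le fun v hv => ?_
  have hcomp : ∀ i, Integrable (fun o => G o i * v i) ν := fun i => (hGi.eval i).mul_const _
  have h1 : (fun i => ∫ o, G o i ∂ν) ⬝ᵥ v = ∫ o, G o ⬝ᵥ v ∂ν := by
    simp only [dotProduct]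
    rw [integral_finsetSum _ fun i _ => hcomp i]
    simp only [integral_mul_const]
  rw [h1]
  have h2 : ∫ o, G o ⬝ᵥ v ∂ν ≤ ∫ o, (c / 2 * (dualNorm p (G o) ^ 2 / c ^ 2) + c / 2) ∂ν := by
    refine integral_mono (integrable_finsetSum _ fun i _ => hcomp i)
      ((hi.const_mul (c / 2)).add (integrable_const (c / 2))) fun o => ?_
    have h3 := dotProduct_le_dualNorm_of_le_one hp (G o) hv
    have h1 : c / 2 * (dualNorm p (G o) ^ 2 / c ^ 2) + c / 2 - dualNorm p (G o)
        = (dualNorm p (G o) - c) ^ 2 / (2 * c) := by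
      field_simp
      ring
    have h2 : 0 ≤ (dualNorm p (G o) - c) ^ 2 / (2 * c) := by positivity
    show G o ⬝ᵥ v ≤ c / 2 * (dualNorm p (G o) ^ 2 / c ^ 2) + c / 2
    linarith
  rw [integral_add (hi.const_mul (c / 2)) (integrable_const (c / 2)), integral_const_mul,
    integral_const] at h2
  simp only [probReal_univ, one_smul] at h2
  nlinarith

end LightTails

/-! ## Distance-generating functions -/

namespace IsDistanceGenerating

variable {n : ℕ} {K : Set (Fin n → ℝ)} {p : Seminorm ℝ (Fin n → ℝ)} {α : ℝ}
  {ω : (Fin n → ℝ) → ℝ} {dω : (Fin n → ℝ) → ((Fin n → ℝ) →L[ℝ] ℝ)}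

/-- A closed set carrying a distance-generating function that is bounded above is compact. -/
theorem isCompact (h : IsDistanceGenerating K p α ω dω) (hp : ∀ v, p v = 0 → v = 0)
    (hK : IsClosed K) (hconv : Convex ℝ K) (hne : K.Nonempty) (hb : BddAbove (ω '' K)) :
    IsCompact K := by
  obtain ⟨c, hc, hpc⟩ := exists_norm_le_seminorm hp
  obtain ⟨u, hu⟩ := hne
  obtain ⟨C, hC⟩ := hb
  have hcomp : IsCompact (K ∩ Metric.closedBall u 1) :=
    (isCompact_closedBall u 1).inter_left hK
  obtain ⟨b, hb⟩ := (hcomp.image_of_continuousOn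
    (h.continuousOn.mono Set.inter_subset_left)).bddBelow
  have hα := h.modulus_pos
  refine Metric.isCompact_of_isClosed_isBounded hK
    (Metric.isBounded_closedBall (x := u) (r := 1 + 2 * (C - b) / (α * c ^ 2)) |>.subset
      fun v hv => ?_)
  have hCu : ω u ≤ C := hC ⟨u, hu, rfl⟩
  have hCv : ω v ≤ C := hC ⟨v, hv, rfl⟩
  have hbu : b ≤ ω u := hb ⟨u, ⟨hu, by simp⟩, rfl⟩
  rw [Metric.mem_closedBall, dist_eq_norm]
  set R := ‖v - u‖ with hR
  rcases le_or_gt R 1 with hR1 | hR1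
  · have : 0 ≤ 2 * (C - b) / (α * c ^ 2) := div_nonneg (by linarith) (by positivity)
    linarith
  · have hR0 : 0 < R := by linarith
    have hRi : R⁻¹ ≤ 1 := inv_le_one_of_one_le₀ hR1.le
    have hRi0 : 0 < R⁻¹ := inv_pos.2 hR0
    -- The point at distance `1` from `u` towards a far `v`: there `ω ≥ b`, while strong convexity
    -- puts `ω` below `C - (R - 1)αc²/2`, so `R` is bounded.
    have hmem : R⁻¹ • v + (1 - R⁻¹) • u ∈ K :=
      hconv hv hu hRi0.le (by linarith) (by ring)
    have hball : R⁻¹ • v + (1 - R⁻¹) • u ∈ Metric.closedBall u 1 := by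
      rw [Metric.mem_closedBall, dist_eq_norm]
      have : R⁻¹ • v + (1 - R⁻¹) • u - u = R⁻¹ • (v - u) := by module
      rw [this, norm_smul, Real.norm_of_nonneg hRi0.le, ← hR, inv_mul_cancel₀ hR0.ne']
    have h1 := hb ⟨_, ⟨hmem, hball⟩, rfl⟩
    have h2 := h.stronglyConvex v hv u hu R⁻¹ (1 - R⁻¹) hRi0.le (by linarith) (by ring)
    have h3 : (c * R) ^ 2 ≤ p (v - u) ^ 2 := by
      gcongr
      exact hpc _
    have h4 : α / 2 * (R⁻¹ * (1 - R⁻¹)) * (c * R) ^ 2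
        ≤ α / 2 * (R⁻¹ * (1 - R⁻¹)) * p (v - u) ^ 2 := by
      have : 0 ≤ 1 - R⁻¹ := by linarith
      gcongr
    have h5 : α / 2 * (R⁻¹ * (1 - R⁻¹)) * (c * R) ^ 2 = (R - 1) * (α * c ^ 2) / 2 := by
      field_simp
    have h6 : R⁻¹ * ω v + (1 - R⁻¹) * ω u ≤ C := by
      have : 0 ≤ 1 - R⁻¹ := by linarith
      nlinarith
    have h7 : R - 1 ≤ 2 * (C - b) / (α * c ^ 2) := by
      rw [le_div_iff₀ (by positivity)]
      linarith
    linarith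

theorem sub_le_diameter_sq (h : IsDistanceGenerating K p α ω dω) (hK : IsCompact K)
    {u v : Fin n → ℝ} (hu : u ∈ K) (hv : v ∈ K) : ω u - ω v ≤ diameter K ω ^ 2 := by
  have hc := hK.image_of_continuousOn h.continuousOn
  have h1 := le_csSup hc.bddAbove ⟨u, hu, rfl⟩
  have h2 := csInf_le hc.bddBelow ⟨v, hv, rfl⟩
  have h3 := le_csSup hc.bddAbove ⟨v, hv, rfl⟩
  rw [diameter, Real.sq_sqrt (by linarith)]
  linarith

/-- A strongly convex function cannot be constant on a segment: its value at the midpoint lies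
strictly below the mean of the end values. -/
theorem diameter_pos (h : IsDistanceGenerating K p α ω dω) (hp : ∀ v, p v = 0 → v = 0)
    (hK : IsCompact K) (hconv : Convex ℝ K) {u v : Fin n → ℝ} (hu : u ∈ K) (hv : v ∈ K)
    (huv : u ≠ v) : 0 < diameter K ω := by
  have hα := h.modulus_pos
  have h0 : 0 ≤ diameter K ω := Real.sqrt_nonneg _
  have hw : (1 / 2 : ℝ) • u + (1 / 2 : ℝ) • v ∈ K :=
    hconv hu hv (by norm_num) (by norm_num) (by norm_num)
  have h1 := h.stronglyConvex u hu v hv (1 / 2) (1 / 2) (by norm_num) (by norm_num) (by norm_num)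
  have h2 := h.sub_le_diameter_sq hK hu hw
  have h3 := h.sub_le_diameter_sq hK hv hw
  have hpos : 0 < p (u - v) :=
    lt_of_le_of_ne (apply_nonneg p _) fun h => huv (sub_eq_zero.1 (hp _ h.symm))
  have h4 : 0 < α / 2 * (1 / 2 * (1 / 2)) * p (u - v) ^ 2 := by positivity
  refine lt_of_le_of_ne h0 fun h5 => ?_
  rw [← h5] at h2 h3
  linarith

end IsDistanceGenerating

end SMD

/-! ## The product geometry -/

namespace SMD

/-- The pairing of `ℝᵈ × ℝᵏ` with itself, as a map into the dual space. -/
noncomputable def pairDual (d k : ℕ) : ((Fin d → ℝ) × (Fin k → ℝ)) →L[ℝ]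
    (((Fin d → ℝ) × (Fin k → ℝ)) →L[ℝ] ℝ) :=
  LinearMap.toContinuousLinearMap
    { toFun := fun ζ => ∑ i, ζ.1 i • (ContinuousLinearMap.proj i).comp (ContinuousLinearMap.fst ℝ _ _)
        + ∑ i, ζ.2 i • (ContinuousLinearMap.proj i).comp (ContinuousLinearMap.snd ℝ _ _)
      map_add' := fun ζ ζ' => by
        simp only [Prod.fst_add, Prod.snd_add, Pi.add_apply, add_smul, Finset.sum_add_distrib]
        abel
      map_smul' := fun c ζ => by
        simp only [Prod.smul_fst, Prod.smul_snd, Pi.smul_apply, smul_eq_mul, mul_smul,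
          Finset.smul_sum, smul_add, RingHom.id_apply] }

theorem pairDual_apply {d k : ℕ} (ζ w : (Fin d → ℝ) × (Fin k → ℝ)) :
    pairDual d k ζ w = ζ.1 ⬝ᵥ w.1 + ζ.2 ⬝ᵥ w.2 := by
  simp [pairDual, dotProduct]

/-- The vector representing a functional on `ℝᵈ × ℝᵏ` on the first factor. -/
def dualFst {d k : ℕ} (ζ : ((Fin d → ℝ) × (Fin k → ℝ)) →L[ℝ] ℝ) : Fin d → ℝ :=
  fun i => ζ (Pi.single i 1, 0)

/-- The vector representing a functional on `ℝᵈ × ℝᵏ` on the second factor. -/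
def dualSnd {d k : ℕ} (ζ : ((Fin d → ℝ) × (Fin k → ℝ)) →L[ℝ] ℝ) : Fin k → ℝ :=
  fun i => ζ (0, Pi.single i 1)

section Dual

variable {d k : ℕ} (ζ ζ' : ((Fin d → ℝ) × (Fin k → ℝ)) →L[ℝ] ℝ)

theorem dualFst_dotProduct (w : Fin d → ℝ) : dualFst ζ ⬝ᵥ w = ζ (w, 0) := by
  have h : (w, (0 : Fin k → ℝ)) = ∑ i, w i • ((Pi.single i 1, 0) : (Fin d → ℝ) × (Fin k → ℝ)) := by
    ext j
    · simp [Prod.fst_sum, Finset.sum_apply, Pi.single_apply]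
    · simp [Prod.snd_sum, Finset.sum_apply]
  rw [h, map_sum]
  simp only [map_smul, smul_eq_mul, dotProduct, dualFst]
  exact Finset.sum_congr rfl fun i _ => mul_comm _ _

theorem dualSnd_dotProduct (w : Fin k → ℝ) : dualSnd ζ ⬝ᵥ w = ζ (0, w) := by
  have h : ((0 : Fin d → ℝ), w) = ∑ i, w i • ((0, Pi.single i 1) : (Fin d → ℝ) × (Fin k → ℝ)) := by
    ext j
    · simp [Prod.fst_sum, Finset.sum_apply]
    · simp [Prod.snd_sum, Finset.sum_apply, Pi.single_apply]
  rw [h, map_sum]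
  simp only [map_smul, smul_eq_mul, dotProduct, dualSnd]
  exact Finset.sum_congr rfl fun i _ => mul_comm _ _

theorem apply_eq_dualFst_add_dualSnd (w : (Fin d → ℝ) × (Fin k → ℝ)) :
    ζ w = dualFst ζ ⬝ᵥ w.1 + dualSnd ζ ⬝ᵥ w.2 := by
  rw [dualFst_dotProduct, dualSnd_dotProduct, ← map_add]
  simp

theorem dualFst_smul (c : ℝ) : dualFst (c • ζ) = c • dualFst ζ := by
  ext i; simp [dualFst]

theorem dualSnd_smul (c : ℝ) : dualSnd (c • ζ) = c • dualSnd ζ := by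
  ext i; simp [dualSnd]

theorem dualFst_sub : dualFst (ζ - ζ') = dualFst ζ - dualFst ζ' := by
  ext i; simp [dualFst]

theorem dualSnd_sub : dualSnd (ζ - ζ') = dualSnd ζ - dualSnd ζ' := by
  ext i; simp [dualSnd]

theorem dualFst_pairDual (z : (Fin d → ℝ) × (Fin k → ℝ)) : dualFst (pairDual d k z) = z.1 := by
  ext i; simp [dualFst, pairDual_apply]

theorem dualSnd_pairDual (z : (Fin d → ℝ) × (Fin k → ℝ)) : dualSnd (pairDual d k z) = z.2 := by
  ext i; simp [dualSnd, pairDual_apply]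

theorem continuous_dualFst : Continuous (dualFst (d := d) (k := k)) :=
  continuous_pi fun _ => (ContinuousLinearMap.apply ℝ ℝ _).continuous

theorem continuous_dualSnd : Continuous (dualSnd (d := d) (k := k)) :=
  continuous_pi fun _ => (ContinuousLinearMap.apply ℝ ℝ _).continuous

end Dual

namespace Geometry

variable {d m : ℕ} {Ξ : Fin (m + 1) → Type*} [∀ i, MeasurableSpace (Ξ i)] {S : Problem d Ξ}

/-- The derivative of `ω_z` as a functional. -/
noncomputable def derivZ (B : Geometry S) (z : (Fin d → ℝ) × (Fin (m + 1) → ℝ)) :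
    ((Fin d → ℝ) × (Fin (m + 1) → ℝ)) →L[ℝ] ℝ :=
  (2 * B.Dx ^ 2)⁻¹ • (B.dωx z.1).comp (ContinuousLinearMap.fst ℝ _ _)
    + (2 * B.Dy ^ 2)⁻¹ • (B.dωy z.2).comp (ContinuousLinearMap.snd ℝ _ _)

theorem derivZ_apply (B : Geometry S) (z w : (Fin d → ℝ) × (Fin (m + 1) → ℝ)) :
    B.derivZ z w = B.dωz z w := by
  simp [derivZ, dωz, div_eq_inv_mul]

/-- The squared norm on `ℝᵈ × ℝᵐ⁺¹` for which `ω_z` has modulus `1`. -/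
noncomputable def sqNorm (B : Geometry S) (w : (Fin d → ℝ) × (Fin (m + 1) → ℝ)) : ℝ :=
  B.αx / (2 * B.Dx ^ 2) * B.normX w.1 ^ 2 + B.αy / (2 * B.Dy ^ 2) * B.normY w.2 ^ 2

/-- The squared norm dual to `sqNorm`. -/
noncomputable def sqDualNorm (B : Geometry S)
    (ζ : ((Fin d → ℝ) × (Fin (m + 1) → ℝ)) →L[ℝ] ℝ) : ℝ :=
  2 * B.Dx ^ 2 / B.αx * dualNorm B.normX (dualFst ζ) ^ 2
    + 2 * B.Dy ^ 2 / B.αy * dualNorm B.normY (dualSnd ζ) ^ 2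

theorem isCompact_X (B : Geometry S) : IsCompact S.X :=
  B.distX.isCompact B.normX_definite S.isClosed_X S.convex_X S.nonempty_X B.bddAbove_ωx

theorem isCompact_Y (S : Problem d Ξ) : IsCompact S.Y := isCompact_stdSimplex ℝ (Fin (m + 1))

theorem convex_Y (S : Problem d Ξ) : Convex ℝ S.Y := convex_stdSimplex ℝ (Fin (m + 1))

theorem nonempty_Y (S : Problem d Ξ) : S.Y.Nonempty :=
  ⟨_, single_mem_stdSimplex ℝ (0 : Fin (m + 1))⟩

/-- Were `X` a single point, the feasible point would be optimal, contradicting `f₀(x̃) > f*`. This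
keeps the weights `1 / (2 D_x²)` genuine. -/
theorem Dx_pos (B : Geometry S) (hS : S.StrictlyFeasible) : 0 < B.Dx := by
  obtain ⟨x, hx, hfeas, hlt⟩ := hS
  have hex : ∃ x' ∈ S.X, x' ≠ x := by
    by_contra! hall
    have : S.f 0 '' {x ∈ S.X | ∀ i : Fin m, S.f i.succ x ≤ S.level i} = {S.f 0 x} := by
      refine Set.Subset.antisymm ?_ ?_
      · rintro _ ⟨x', hx', rfl⟩
        rw [hall x' hx'.1]
        rfl
      · rintro _ rfl
        exact ⟨x, ⟨hx, fun i => by linarith [hfeas i]⟩, rfl⟩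
    rw [Problem.fstar, this, csInf_singleton] at hlt
    exact lt_irrefl _ hlt
  obtain ⟨x', hx', hne⟩ := hex
  exact B.distX.diameter_pos B.normX_definite B.isCompact_X S.convex_X hx' hx hne

theorem Dy_pos (B : Geometry S) (hm : 1 ≤ m) : 0 < B.Dy := by
  refine B.distY.diameter_pos B.normY_definite (isCompact_Y S) (convex_Y S)
    (single_mem_stdSimplex ℝ (0 : Fin (m + 1))) (single_mem_stdSimplex ℝ (Fin.last m)) fun h => ?_
  have h0 : (0 : Fin (m + 1)) ≠ Fin.last m := by
    intro h
    have := congrArg Fin.val h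
    simp at this
    omega
  have := congrFun h 0
  simp [h0] at this

theorem ωz_sub_le_one (B : Geometry S) (hDx : 0 < B.Dx) (hDy : 0 < B.Dy)
    {u v : (Fin d → ℝ) × (Fin (m + 1) → ℝ)} (hu : u ∈ S.X ×ˢ S.Y) (hv : v ∈ S.X ×ˢ S.Y) :
    B.ωz u - B.ωz v ≤ 1 := by
  have h1 : B.ωx u.1 - B.ωx v.1 ≤ B.Dx ^ 2 := B.distX.sub_le_diameter_sq B.isCompact_X hu.1 hv.1
  have h2 : B.ωy u.2 - B.ωy v.2 ≤ B.Dy ^ 2 :=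
    B.distY.sub_le_diameter_sq (isCompact_Y S) hu.2 hv.2
  have h3 : (B.ωx u.1 - B.ωx v.1) / (2 * B.Dx ^ 2) ≤ 1 / 2 := by
    rw [div_le_iff₀ (by positivity)]; linarith
  have h4 : (B.ωy u.2 - B.ωy v.2) / (2 * B.Dy ^ 2) ≤ 1 / 2 := by
    rw [div_le_iff₀ (by positivity)]; linarith
  rw [sub_div] at h3 h4
  unfold ωz
  linarith

/-- Freezing the second coordinate in the subgradient inequality of `ω_z` leaves one for the
rescaled `ω_x`. -/
theorem subgradientDomain_fst (B : Geometry S) (hDx : 0 < B.Dx)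
    {z : (Fin d → ℝ) × (Fin (m + 1) → ℝ)} (hz : z ∈ subgradientDomain (S.X ×ˢ S.Y) B.ωz) :
    z.1 ∈ subdiffDomain S.X B.ωx := by
  obtain ⟨hzK, g, hg⟩ := hz
  refine ⟨hzK.1, (2 * B.Dx ^ 2) • dualFst g, fun u hu => ?_⟩
  have h := hg (u, z.2) ⟨hu, hzK.2⟩
  rw [smul_dotProduct, dualFst_dotProduct, smul_eq_mul]
  have h1 : (u, z.2) - z = (u - z.1, 0) := by ext <;> simp
  rw [h1] at h
  simp only [ωz] at h
  have h2 : B.ωx z.1 / (2 * B.Dx ^ 2) + g (u - z.1, 0) ≤ B.ωx u / (2 * B.Dx ^ 2) := by linarith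
  have h3 := mul_le_mul_of_nonneg_left h2 (by positivity : 0 ≤ 2 * B.Dx ^ 2)
  rwa [mul_add, mul_div_cancel₀ _ (by positivity), mul_div_cancel₀ _ (by positivity)] at h3

theorem subgradientDomain_snd (B : Geometry S) (hDy : 0 < B.Dy)
    {z : (Fin d → ℝ) × (Fin (m + 1) → ℝ)} (hz : z ∈ subgradientDomain (S.X ×ˢ S.Y) B.ωz) :
    z.2 ∈ subdiffDomain S.Y B.ωy := by
  obtain ⟨hzK, g, hg⟩ := hz
  refine ⟨hzK.2, (2 * B.Dy ^ 2) • dualSnd g, fun u hu => ?_⟩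
  have h := hg (z.1, u) ⟨hzK.1, hu⟩
  rw [smul_dotProduct, dualSnd_dotProduct, smul_eq_mul]
  have h1 : (z.1, u) - z = (0, u - z.2) := by ext <;> simp
  rw [h1] at h
  simp only [ωz] at h
  have h2 : B.ωy z.2 / (2 * B.Dy ^ 2) + g (0, u - z.2) ≤ B.ωy u / (2 * B.Dy ^ 2) := by linarith
  have h3 := mul_le_mul_of_nonneg_left h2 (by positivity : 0 ≤ 2 * B.Dy ^ 2)
  rwa [mul_add, mul_div_cancel₀ _ (by positivity), mul_div_cancel₀ _ (by positivity)] at h3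

theorem continuousOn_ωz (B : Geometry S) :
    ContinuousOn B.ωz (S.X ×ˢ S.Y) :=
    ((B.distX.continuousOn.comp continuousOn_fst fun _ h => h.1).div_const _).add
      ((B.distY.continuousOn.comp continuousOn_snd fun _ h => h.2).div_const _)

theorem stronglyConvex_ωz (B : Geometry S) (hDx : 0 < B.Dx) (hDy : 0 < B.Dy) :
    ∀ u ∈ S.X ×ˢ S.Y, ∀ v ∈ S.X ×ˢ S.Y,
    ∀ a b : ℝ, 0 ≤ a → 0 ≤ b → a + b = 1 →
    B.ωz (a • u + b • v) ≤ a * B.ωz u + b * B.ωz v - 1 / 2 * (a * b) * B.sqNorm (u - v) := fun u hu v hv a b ha hb hab => by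
    have h1 := B.distX.stronglyConvex _ hu.1 _ hv.1 a b ha hb hab
    have h2 := B.distY.stronglyConvex _ hu.2 _ hv.2 a b ha hb hab
    have h3 := div_le_div_of_nonneg_right h1 (by positivity : 0 ≤ 2 * B.Dx ^ 2)
    have h4 := div_le_div_of_nonneg_right h2 (by positivity : 0 ≤ 2 * B.Dy ^ 2)
    simp only [ωz, sqNorm, Prod.fst_add, Prod.snd_add, Prod.smul_fst, Prod.smul_snd,
      Prod.fst_sub, Prod.snd_sub]
    refine (add_le_add h3 h4).trans (le_of_eq ?_)
    ring

theorem sqNorm_coercive (B : Geometry S) (hDx : 0 < B.Dx) (hDy : 0 < B.Dy) :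
    ∃ c > 0, ∀ w, c * ‖w‖ ^ 2 ≤ B.sqNorm w := by
    obtain ⟨c, hc, hcp⟩ := exists_norm_le_seminorm B.normX_definite
    obtain ⟨c', hc', hcp'⟩ := exists_norm_le_seminorm B.normY_definite
    have hαx := B.distX.modulus_pos
    have hαy := B.distY.modulus_pos
    have hpx : 0 < B.αx / (2 * B.Dx ^ 2) * c ^ 2 := by positivity
    have hpy : 0 < B.αy / (2 * B.Dy ^ 2) * c' ^ 2 := by positivity
    refine ⟨min (B.αx / (2 * B.Dx ^ 2) * c ^ 2) (B.αy / (2 * B.Dy ^ 2) * c' ^ 2),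
      lt_min hpx hpy, fun w => ?_⟩
    have h1 : B.αx / (2 * B.Dx ^ 2) * c ^ 2 * ‖w.1‖ ^ 2
        ≤ B.αx / (2 * B.Dx ^ 2) * B.normX w.1 ^ 2 := by
      rw [mul_assoc, ← mul_pow]
      gcongr
      exact hcp _
    have h2 : B.αy / (2 * B.Dy ^ 2) * c' ^ 2 * ‖w.2‖ ^ 2
        ≤ B.αy / (2 * B.Dy ^ 2) * B.normY w.2 ^ 2 := by
      rw [mul_assoc, ← mul_pow]
      gcongr
      exact hcp' _
    have h3 : 0 ≤ B.αx / (2 * B.Dx ^ 2) * B.normX w.1 ^ 2 := by positivity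
    have h4 : 0 ≤ B.αy / (2 * B.Dy ^ 2) * B.normY w.2 ^ 2 := by positivity
    unfold sqNorm
    rw [Prod.norm_def]
    rcases max_choice ‖w.1‖ ‖w.2‖ with h | h <;> rw [h]
    · have := mul_le_mul_of_nonneg_right (min_le_left (B.αx / (2 * B.Dx ^ 2) * c ^ 2)
        (B.αy / (2 * B.Dy ^ 2) * c' ^ 2)) (sq_nonneg ‖w.1‖)
      linarith
    · have := mul_le_mul_of_nonneg_right (min_le_right (B.αx / (2 * B.Dx ^ 2) * c ^ 2)
        (B.αy / (2 * B.Dy ^ 2) * c' ^ 2)) (sq_nonneg ‖w.2‖)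
      linarith

theorem hasFDerivWithinAt_ωz (B : Geometry S) (hDx : 0 < B.Dx) (hDy : 0 < B.Dy) :
    ∀ z ∈ subgradientDomain (S.X ×ˢ S.Y) B.ωz,
    HasFDerivWithinAt B.ωz (B.derivZ z) (S.X ×ˢ S.Y) z := fun z hz => by
    have h1 := (B.distX.hasDerivative _ (B.subgradientDomain_fst hDx hz)).comp z
      (hasFDerivWithinAt_fst (s := S.X ×ˢ S.Y)) fun _ h => h.1
    have h2 := (B.distY.hasDerivative _ (B.subgradientDomain_snd hDy hz)).comp z
      (hasFDerivWithinAt_snd (s := S.X ×ˢ S.Y)) fun _ h => h.2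
    have h3 := (h1.const_mul (2 * B.Dx ^ 2)⁻¹).add (h2.const_mul (2 * B.Dy ^ 2)⁻¹)
    refine h3.congr_of_eventuallyEq (Filter.Eventually.of_forall fun w => ?_) ?_ <;>
      simp [ωz, div_eq_inv_mul]

theorem continuousOn_derivZ (B : Geometry S) (hDx : 0 < B.Dx) (hDy : 0 < B.Dy) :
    ContinuousOn B.derivZ (subgradientDomain (S.X ×ˢ S.Y) B.ωz) := by
    have h1 : ContinuousOn (fun z : (Fin d → ℝ) × (Fin (m + 1) → ℝ) => B.dωx z.1)
        (subgradientDomain (S.X ×ˢ S.Y) B.ωz) :=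
      B.distX.continuousOn_derivative.comp continuousOn_fst
        fun z hz => B.subgradientDomain_fst hDx hz
    have h2 : ContinuousOn (fun z : (Fin d → ℝ) × (Fin (m + 1) → ℝ) => B.dωy z.2)
        (subgradientDomain (S.X ×ˢ S.Y) B.ωz) :=
      B.distY.continuousOn_derivative.comp continuousOn_snd
        fun z hz => B.subgradientDomain_snd hDy hz
    have h3 := ((ContinuousLinearMap.fst ℝ (Fin d → ℝ) (Fin (m + 1) → ℝ)).precomp
      ℝ).continuous.comp_continuousOn h1
    have h4 := ((ContinuousLinearMap.snd ℝ (Fin d → ℝ) (Fin (m + 1) → ℝ)).precomp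
      ℝ).continuous.comp_continuousOn h2
    have h5 := (h3.const_smul (2 * B.Dx ^ 2)⁻¹).add (h4.const_smul (2 * B.Dy ^ 2)⁻¹)
    exact h5.congr fun z _ => rfl

theorem sq_apply_le (B : Geometry S) (hDx : 0 < B.Dx) (hDy : 0 < B.Dy) :
    ∀ ζ w, (ζ w) ^ 2 ≤ B.sqDualNorm ζ * B.sqNorm w := fun ζ w => by
    have hαx := B.distX.modulus_pos
    have hαy := B.distY.modulus_pos
    have h1 := abs_dotProduct_le_dualNorm_mul B.normX_definite (dualFst ζ) w.1
    have h2 := abs_dotProduct_le_dualNorm_mul B.normY_definite (dualSnd ζ) w.2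
    rw [apply_eq_dualFst_add_dualSnd]
    have h3 : |dualFst ζ ⬝ᵥ w.1 + dualSnd ζ ⬝ᵥ w.2|
        ≤ dualNorm B.normX (dualFst ζ) * B.normX w.1
          + dualNorm B.normY (dualSnd ζ) * B.normY w.2 :=
      (abs_add_le _ _).trans (add_le_add h1 h2)
    have h4 := sq_le_sq' (by linarith [neg_abs_le (dualFst ζ ⬝ᵥ w.1 + dualSnd ζ ⬝ᵥ w.2)])
      ((le_abs_self _).trans h3)
    refine h4.trans ?_
    unfold sqNorm sqDualNorm
    set a := dualNorm B.normX (dualFst ζ)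
    set b := dualNorm B.normY (dualSnd ζ)
    set s := B.normX w.1
    set t := B.normY w.2
    set P := 2 * B.Dx ^ 2 / B.αx with hP
    set R := 2 * B.Dy ^ 2 / B.αy with hR
    have hPpos : 0 < P := by positivity
    have hRpos : 0 < R := by positivity
    have e1 : B.αx / (2 * B.Dx ^ 2) = P⁻¹ := by rw [hP, inv_div]
    have e2 : B.αy / (2 * B.Dy ^ 2) = R⁻¹ := by rw [hR, inv_div]
    rw [e1, e2]
    -- Lagrange's identity behind the weighted Cauchy–Schwarz inequality.
    have key : (P * a ^ 2 + R * b ^ 2) * (P⁻¹ * s ^ 2 + R⁻¹ * t ^ 2) - (a * s + b * t) ^ 2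
        = (P * a * t - R * b * s) ^ 2 / (P * R) := by
      field_simp
      ring
    have : 0 ≤ (P * a * t - R * b * s) ^ 2 / (P * R) := by positivity
    linarith

theorem sqDualNorm_nonneg (B : Geometry S) :
    ∀ ζ, 0 ≤ B.sqDualNorm ζ := fun ζ => by
    have hαx := B.distX.modulus_pos
    have hαy := B.distY.modulus_pos
    unfold sqDualNorm
    positivity

theorem sqDualNorm_smul (B : Geometry S) :
    ∀ (c : ℝ) ζ, B.sqDualNorm (c • ζ) = c ^ 2 * B.sqDualNorm ζ := fun c ζ => by
    unfold sqDualNorm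
    rw [dualFst_smul, dualSnd_smul, dualNorm_smul B.normX_definite,
      dualNorm_smul B.normY_definite, mul_pow, mul_pow, sq_abs]
    ring

theorem sqDualNorm_sub_le (B : Geometry S) :
    ∀ ζ ζ',
    B.sqDualNorm (ζ - ζ') ≤ 2 * B.sqDualNorm ζ + 2 * B.sqDualNorm ζ' := fun ζ ζ' => by
    have hαx := B.distX.modulus_pos
    have hαy := B.distY.modulus_pos
    unfold sqDualNorm
    rw [dualFst_sub, dualSnd_sub]
    have sq : ∀ a b c : ℝ, 0 ≤ a → a ≤ b + c → a ^ 2 ≤ 2 * b ^ 2 + 2 * c ^ 2 := fun a b c h0 h => by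
      nlinarith [sq_nonneg (b - c)]
    have h1 := sq _ _ _ (dualNorm_nonneg B.normX_definite _)
      (dualNorm_sub_le B.normX_definite (dualFst ζ) (dualFst ζ'))
    have h2 := sq _ _ _ (dualNorm_nonneg B.normY_definite _)
      (dualNorm_sub_le B.normY_definite (dualSnd ζ) (dualSnd ζ'))
    have h3 := mul_le_mul_of_nonneg_left h1 (by positivity : 0 ≤ 2 * B.Dx ^ 2 / B.αx)
    have h4 := mul_le_mul_of_nonneg_left h2 (by positivity : 0 ≤ 2 * B.Dy ^ 2 / B.αy)
    linarith

theorem continuous_sqDualNorm (B : Geometry S) :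
    Continuous B.sqDualNorm := by
  have h1 := (continuous_dualNorm B.normX_definite).comp
    (continuous_dualFst (d := d) (k := m + 1))
  have h2 := (continuous_dualNorm B.normY_definite).comp
    (continuous_dualSnd (d := d) (k := m + 1))
  exact ((h1.pow 2).const_mul _).add ((h2.pow 2).const_mul _)

theorem isProxSetup (B : Geometry S) (hDx : 0 < B.Dx) (hDy : 0 < B.Dy) :
    IsProxSetup (S.X ×ˢ S.Y) B.ωz B.derivZ B.sqNorm B.sqDualNorm where
  isCompact := B.isCompact_X.prod (isCompact_Y S)
  convex := S.convex_X.prod (convex_Y S)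
  nonempty := S.nonempty_X.prod (nonempty_Y S)
  continuousOn := B.continuousOn_ωz
  stronglyConvex := B.stronglyConvex_ωz hDx hDy
  coercive := B.sqNorm_coercive hDx hDy
  hasDerivative := B.hasFDerivWithinAt_ωz hDx hDy
  continuousOn_derivative := B.continuousOn_derivZ hDx hDy
  pairing := B.sq_apply_le hDx hDy
  q_nonneg := B.sqDualNorm_nonneg
  q_smul := B.sqDualNorm_smul
  q_sub_le := B.sqDualNorm_sub_le
  q_continuous := B.continuous_sqDualNorm

/-- The dual vectors whose prox-points are the iterates. -/
noncomputable def dualIterate (B : Geometry S) (r : ℝ) (dF : ∀ i, (Fin d → ℝ) → Ξ i → (Fin d → ℝ))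
    (γ : ℕ → ℝ) (ξ : ℕ → ∀ i, Ξ i) : ℕ → (((Fin d → ℝ) × (Fin (m + 1) → ℝ)) →L[ℝ] ℝ)
  | 0 => 0
  | t + 1 => γ t • pairDual d (m + 1) (S.G r dF (B.iterate r dF γ ξ t) (ξ t))
      - B.derivZ (B.iterate r dF γ ξ t)

/-- In the prox objective, everything except `ω_z(z)` and the linear form `γG - ∇ω_z(z₁)` is
constant in `z`. -/
theorem iterate_eq_proxPoint (B : Geometry S) (r : ℝ)
    (dF : ∀ i, (Fin d → ℝ) → Ξ i → (Fin d → ℝ)) (γ : ℕ → ℝ) (ξ : ℕ → ∀ i, Ξ i) (t : ℕ) :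
    B.iterate r dF γ ξ t = proxPoint (S.X ×ˢ S.Y) B.ωz (B.dualIterate r dF γ ξ t) := by
  cases t with
  | zero =>
    rw [iterate, proxPoint]
    exact argminOn_congr 0 fun z => by simp [dualIterate]
  | succ t =>
    rw [iterate, prox, proxPoint]
    set z₁ := B.iterate r dF γ ξ t with hz₁
    refine argminOn_congr (-(pairDual d (m + 1) (γ t • S.G r dF z₁ (ξ t)) z₁) - B.ωz z₁
      + B.derivZ z₁ z₁) fun z => ?_
    have h := pairDual_apply (γ t • S.G r dF z₁ (ξ t)) (z - z₁)
    simp only [Prod.fst_sub, Prod.snd_sub] at h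
    rw [← h, V, ← derivZ_apply, dualIterate, ← hz₁]
    simp only [map_sub, map_smul, sub_apply, smul_apply]
    ring

end Geometry

end SMD

/-! ## The stochastic subgradients -/

/-- Convexity of `exp`. It merges the two light tails: `q(G)/M²` is a convex combination of the
normalized squares, since the two summands of `M²` divided by `M²` sum to one. -/
theorem exp_moment_convex {Ω' : Type*} [MeasurableSpace Ω'] {ν : Measure Ω'} {X Y : Ω' → ℝ}
    (hX : Measurable X) (hY : Measurable Y)
    (hXe : ∫⁻ o, ENNReal.ofReal (Real.exp (X o)) ∂ν ≤ ENNReal.ofReal (Real.exp 1))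
    (hYe : ∫⁻ o, ENNReal.ofReal (Real.exp (Y o)) ∂ν ≤ ENNReal.ofReal (Real.exp 1))
    {a b : ℝ} (ha : 0 ≤ a) (hb : 0 ≤ b) (hab : a + b = 1) :
    ∫⁻ o, ENNReal.ofReal (Real.exp (a * X o + b * Y o)) ∂ν ≤ ENNReal.ofReal (Real.exp 1) := by
  have hXi := integrable_of_lintegral_ofReal_le hX.exp (fun _ => (Real.exp_pos _).le) hXe
  have hYi := integrable_of_lintegral_ofReal_le hY.exp (fun _ => (Real.exp_pos _).le) hYe
  have h1 := integral_le_of_lintegral_ofReal_le hX.exp (Real.exp_pos 1).le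
    (fun _ => (Real.exp_pos _).le) hXe
  have h2 := integral_le_of_lintegral_ofReal_le hY.exp (Real.exp_pos 1).le
    (fun _ => (Real.exp_pos _).le) hYe
  have hle : ∀ o, Real.exp (a * X o + b * Y o) ≤ a * Real.exp (X o) + b * Real.exp (Y o) :=
    fun o => convexOn_exp.2 (Set.mem_univ _) (Set.mem_univ _) ha hb hab
  refine (lintegral_mono fun o => ENNReal.ofReal_le_ofReal (hle o)).trans
    (lintegral_ofReal_le_of_integral_le ((hXi.const_mul a).add (hYi.const_mul b))
      (fun o => by positivity) ?_)
  rw [integral_add (hXi.const_mul a) (hYi.const_mul b), integral_const_mul, integral_const_mul]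
  calc _ ≤ a * Real.exp 1 + b * Real.exp 1 := by gcongr
    _ = Real.exp 1 := by rw [← add_mul, hab, one_mul]

namespace SMD

variable {d m : ℕ} {Ξ : Fin (m + 1) → Type*} [∀ i, MeasurableSpace (Ξ i)] {S : Problem d Ξ}

namespace Problem

/-- `F` is a Carathéodory function on `X × Ξ_i`, continuous in one variable and measurable in the
other, hence jointly measurable. -/
theorem measurable_F_comp (S : Problem d Ξ) (i : Fin (m + 1)) {A : Type*} [MeasurableSpace A]
    {x : A → (Fin d → ℝ)} (hx : Measurable x) (hxX : ∀ a, x a ∈ S.X) {o : A → Ξ i}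
    (ho : Measurable o) : Measurable fun a => S.F i (x a) (o a) := by
  have h : Measurable (Function.uncurry fun (u : S.X) (o : Ξ i) => S.F i u o) :=
    measurable_uncurry_of_continuous_of_measurable
      (fun o => continuousOn_iff_continuous_domRestrict.1 (S.continuousOn_F i o))
      (fun u => S.measurable_F i u u.2)
  exact h.comp ((hx.subtype_mk (h := hxX)).prodMk ho)

theorem phi_eq (S : Problem d Ξ) (r : ℝ) {x : Fin d → ℝ} (hx : x ∈ S.X) (y : Fin (m + 1) → ℝ) :
    S.phi r x y = ∑ i, y i * (S.f i x - S.levels r i) := by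
  have := S.isProbabilityMeasure_law
  unfold phi Phi f
  have hi : ∀ i, Integrable (fun ξ : ∀ i, Ξ i => S.F i x (ξ i) - S.levels r i) S.law :=
    fun i => (S.integrable_F i x hx).sub (integrable_const _)
  rw [integral_finsetSum _ fun i _ => (hi i).const_mul _]
  refine Finset.sum_congr rfl fun i _ => ?_
  rw [integral_const_mul, integral_sub (S.integrable_F i x hx) (integrable_const _)]
  simp

theorem integrable_Phi (S : Problem d Ξ) (r : ℝ) {x : Fin d → ℝ} (hx : x ∈ S.X)
    (y : Fin (m + 1) → ℝ) : Integrable (S.Phi r x y) S.law := by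
  have := S.isProbabilityMeasure_law
  exact integrable_finsetSum _ fun i _ =>
    ((S.integrable_F i x hx).sub (integrable_const _)).const_mul _

theorem convexOn_f (S : Problem d Ξ) (i : Fin (m + 1)) : ConvexOn ℝ S.X (S.f i) := by
  refine ⟨S.convex_X, fun x hx x' hx' a b ha hb hab => ?_⟩
  have h1 := S.integrable_F i x hx
  have h2 := S.integrable_F i x' hx'
  have h3 := integral_mono (S.integrable_F i _ (S.convex_X hx hx' ha hb hab))
    ((h1.const_mul a).add (h2.const_mul b))
    fun ξ => (S.convexOn_F i (ξ i)).2 hx hx' ha hb hab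
  rw [integral_add' (h1.const_mul a) (h2.const_mul b), integral_const_mul, integral_const_mul] at h3
  exact h3

/-- The gap function of the saddle-point problem is convex. -/
theorem convexOn_gap (S : Problem d Ξ) (r : ℝ) {u : (Fin d → ℝ) × (Fin (m + 1) → ℝ)}
    (hu : u ∈ S.X ×ˢ S.Y) :
    ConvexOn ℝ (S.X ×ˢ S.Y) fun z => S.phi r z.1 u.2 - S.phi r u.1 z.2 := by
  refine ⟨S.convex_X.prod (convex_stdSimplex ℝ (Fin (m + 1))), ?_⟩
  intro z hz z' hz' a b ha hb hab
  have hmem : a • z.1 + b • z'.1 ∈ S.X := S.convex_X hz.1 hz'.1 ha hb hab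
  show S.phi r (a • z.1 + b • z'.1) u.2 - S.phi r u.1 (a • z.2 + b • z'.2)
    ≤ a * (S.phi r z.1 u.2 - S.phi r u.1 z.2) + b * (S.phi r z'.1 u.2 - S.phi r u.1 z'.2)
  rw [S.phi_eq r hmem, S.phi_eq r hu.1, S.phi_eq r hu.1, S.phi_eq r hu.1, S.phi_eq r hz.1,
    S.phi_eq r hz'.1]
  have h1 : ∑ i, u.2 i * (S.f i (a • z.1 + b • z'.1) - S.levels r i)
      ≤ a * ∑ i, u.2 i * (S.f i z.1 - S.levels r i)
        + b * ∑ i, u.2 i * (S.f i z'.1 - S.levels r i) := by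
    rw [Finset.mul_sum, Finset.mul_sum, ← Finset.sum_add_distrib]
    refine Finset.sum_le_sum fun i _ => ?_
    have h2 := (S.convexOn_f i).2 hz.1 hz'.1 ha hb hab
    have h3 := mul_le_mul_of_nonneg_left h2 (hu.2.1 i)
    simp only [smul_eq_mul] at h3
    have h4 : u.2 i * S.levels r i = (a + b) * (u.2 i * S.levels r i) := by rw [hab, one_mul]
    linarith
  have h2 : ∑ i, (a • z.2 + b • z'.2) i * (S.f i u.1 - S.levels r i)
      = a * ∑ i, z.2 i * (S.f i u.1 - S.levels r i)
        + b * ∑ i, z'.2 i * (S.f i u.1 - S.levels r i) := by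
    rw [Finset.mul_sum, Finset.mul_sum, ← Finset.sum_add_distrib]
    refine Finset.sum_congr rfl fun i _ => ?_
    simp only [Pi.add_apply, Pi.smul_apply, smul_eq_mul]
    ring
  linarith

end Problem

/-! ### Measurability, moments and the gap inequality for the stochastic subgradient. -/

namespace Geometry

theorem M_sq (B : Geometry S) (Mx My : ℝ) :
    B.M Mx My ^ 2 = 2 * B.Dx ^ 2 / B.αx * Mx ^ 2 + 2 * B.Dy ^ 2 / B.αy * My ^ 2 := by
  have hαx := B.distX.modulus_pos
  have hαy := B.distY.modulus_pos
  exact Real.sq_sqrt (by positivity)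

namespace LightTailed

variable {B : Geometry S} {r : ℝ} {dF : ∀ i, (Fin d → ℝ) → Ξ i → (Fin d → ℝ)} {Mx My : ℝ}

theorem M_pos (hLT : B.LightTailed r dF Mx My) (hDx : 0 < B.Dx) : 0 < B.M Mx My := by
  have hαx := B.distX.modulus_pos
  have hαy := B.distY.modulus_pos
  have hMx := hLT.Mx_pos
  exact Real.sqrt_pos.2 (by positivity)

theorem measurable_Gx (hLT : B.LightTailed r dF Mx My) {A : Type*} [MeasurableSpace A]
    {z : A → (Fin d → ℝ) × (Fin (m + 1) → ℝ)} (hz : Measurable z) (hzK : ∀ a, z a ∈ S.X ×ˢ S.Y)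
    {o : A → ∀ i, Ξ i} (ho : Measurable o) :
    Measurable fun a => S.Gx dF (z a).1 (z a).2 (o a) := by
  unfold Problem.Gx
  refine Finset.measurable_sum _ fun i _ => ?_
  refine Measurable.smul ((measurable_pi_apply i).comp (measurable_snd.comp hz)) ?_
  exact (hLT.measurable i).comp
    (((measurable_fst.comp hz).subtype_mk (h := fun a => (hzK a).1)).prodMk
      ((measurable_pi_apply i).comp ho))

theorem measurable_Gy (S : Problem d Ξ) (r : ℝ) {A : Type*} [MeasurableSpace A]
    {x : A → (Fin d → ℝ)} (hx : Measurable x) (hxX : ∀ a, x a ∈ S.X)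
    {o : A → ∀ i, Ξ i} (ho : Measurable o) : Measurable fun a => S.Gy r (x a) (o a) :=
  measurable_pi_lambda _ fun i =>
    (S.measurable_F_comp i hx hxX ((measurable_pi_apply i).comp ho)).sub_const _

theorem measurable_G (hLT : B.LightTailed r dF Mx My) {A : Type*} [MeasurableSpace A]
    {z : A → (Fin d → ℝ) × (Fin (m + 1) → ℝ)} (hz : Measurable z) (hzK : ∀ a, z a ∈ S.X ×ˢ S.Y)
    {o : A → ∀ i, Ξ i} (ho : Measurable o) : Measurable fun a => S.G r dF (z a) (o a) :=
  (hLT.measurable_Gx hz hzK ho).prodMk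
    (measurable_Gy S r (measurable_fst.comp hz) (fun a => (hzK a).1) ho).neg

variable {z : (Fin d → ℝ) × (Fin (m + 1) → ℝ)}

theorem integrable_Gx (hLT : B.LightTailed r dF Mx My) (hz : z ∈ S.X ×ˢ S.Y) :
    Integrable (fun o => S.Gx dF z.1 z.2 o) S.law := by
  have := S.isProbabilityMeasure_law
  exact integrable_of_lightTail B.normX_definite
    (hLT.measurable_Gx (measurable_const (a := z)) (fun _ => hz) measurable_id) hLT.Mx_pos
    (hLT.lightTail_x _ hz.1 _ hz.2)

theorem integrable_Gy (hLT : B.LightTailed r dF Mx My) (hz : z ∈ S.X ×ˢ S.Y) :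
    Integrable (fun o => S.Gy r z.1 o) S.law := by
  have := S.isProbabilityMeasure_law
  exact integrable_of_lightTail B.normY_definite
    (measurable_Gy S r (measurable_const (a := z.1)) (fun _ => hz.1) measurable_id) hLT.My_pos
    (hLT.lightTail_y _ hz.1)

theorem integrable_G (hLT : B.LightTailed r dF Mx My) (hz : z ∈ S.X ×ˢ S.Y) :
    Integrable (fun o => pairDual d (m + 1) (S.G r dF z o)) S.law :=
  (pairDual d (m + 1)).integrable_comp
    ((hLT.integrable_Gx hz).prodMk (hLT.integrable_Gy hz).neg)

theorem dualNorm_neg {n : ℕ} {p : Seminorm ℝ (Fin n → ℝ)} (hp : ∀ v, p v = 0 → v = 0)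
    (ζ : Fin n → ℝ) : dualNorm p (-ζ) = dualNorm p ζ := by
  simpa using dualNorm_smul hp (-1) ζ

theorem exp_moment_G (hLT : B.LightTailed r dF Mx My) (hDx : 0 < B.Dx) (hz : z ∈ S.X ×ˢ S.Y) :
    ∫⁻ o, ENNReal.ofReal (Real.exp (B.sqDualNorm (pairDual d (m + 1) (S.G r dF z o))
      / B.M Mx My ^ 2)) ∂S.law ≤ ENNReal.ofReal (Real.exp 1) := by
  have hαx := B.distX.modulus_pos
  have hαy := B.distY.modulus_pos
  have hMx := hLT.Mx_pos
  have hMy := hLT.My_pos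
  have hM := hLT.M_pos hDx
  have hX : Measurable fun o => dualNorm B.normX (S.Gx dF z.1 z.2 o) ^ 2 / Mx ^ 2 :=
    (((continuous_dualNorm B.normX_definite).measurable.comp
      (hLT.measurable_Gx (measurable_const (a := z)) (fun _ => hz) measurable_id)).pow_const
        2).div_const _
  have hY : Measurable fun o => dualNorm B.normY (S.Gy r z.1 o) ^ 2 / My ^ 2 :=
    (((continuous_dualNorm B.normY_definite).measurable.comp
      (measurable_Gy S r (measurable_const (a := z.1)) (fun _ => hz.1) measurable_id)).pow_const
        2).div_const _
  have h := exp_moment_convex hX hY (hLT.lightTail_x _ hz.1 _ hz.2) (hLT.lightTail_y _ hz.1)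
    (a := 2 * B.Dx ^ 2 / B.αx * Mx ^ 2 / B.M Mx My ^ 2)
    (b := 2 * B.Dy ^ 2 / B.αy * My ^ 2 / B.M Mx My ^ 2) (by positivity) (by positivity)
    (by rw [← add_div, ← M_sq, div_self (by positivity)])
  refine le_of_eq_of_le (lintegral_congr fun o => ?_) h
  congr 2
  unfold sqDualNorm
  rw [dualFst_pairDual, dualSnd_pairDual, Problem.G, dualNorm_neg B.normY_definite]
  field_simp

theorem sqDualNorm_integral_le (hLT : B.LightTailed r dF Mx My) (hz : z ∈ S.X ×ˢ S.Y) :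
    B.sqDualNorm (∫ o, pairDual d (m + 1) (S.G r dF z o) ∂S.law) ≤ B.M Mx My ^ 2 := by
  have := S.isProbabilityMeasure_law
  have hαx := B.distX.modulus_pos
  have hαy := B.distY.modulus_pos
  have hi := hLT.integrable_G hz
  have h1 := dualNorm_integral_le B.normX_definite
    (hLT.measurable_Gx (measurable_const (a := z)) (fun _ => hz) measurable_id) hLT.Mx_pos
    (hLT.lightTail_x _ hz.1 _ hz.2)
  have h2 := dualNorm_integral_le B.normY_definite
    (measurable_Gy S r (measurable_const (a := z.1)) (fun _ => hz.1) measurable_id) hLT.My_pos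
    (hLT.lightTail_y _ hz.1)
  have e1 : dualFst (∫ o, pairDual d (m + 1) (S.G r dF z o) ∂S.law)
      = fun i => ∫ o, S.Gx dF z.1 z.2 o i ∂S.law := by
    ext i
    rw [dualFst, ContinuousLinearMap.integral_apply hi]
    refine integral_congr_ae (Filter.Eventually.of_forall fun o => ?_)
    exact congrFun (dualFst_pairDual (S.G r dF z o)) i
  have e2 : dualSnd (∫ o, pairDual d (m + 1) (S.G r dF z o) ∂S.law)
      = -fun i => ∫ o, S.Gy r z.1 o i ∂S.law := by
    ext i
    rw [dualSnd, ContinuousLinearMap.integral_apply hi, Pi.neg_apply, ← integral_neg]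
    refine integral_congr_ae (Filter.Eventually.of_forall fun o => ?_)
    exact congrFun (dualSnd_pairDual (S.G r dF z o)) i
  unfold sqDualNorm
  rw [e1, e2, dualNorm_neg B.normY_definite, M_sq]
  have h3 := dualNorm_nonneg B.normX_definite (fun i => ∫ o, S.Gx dF z.1 z.2 o i ∂S.law)
  have h4 := dualNorm_nonneg B.normY_definite (fun i => ∫ o, S.Gy r z.1 o i ∂S.law)
  simp only [id] at h1 h2
  gcongr

/-- The expected stochastic subgradient bounds the gap function. -/
theorem gap_le (hLT : B.LightTailed r dF Mx My) (hz : z ∈ S.X ×ˢ S.Y)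
    {u : (Fin d → ℝ) × (Fin (m + 1) → ℝ)} (hu : u ∈ S.X ×ˢ S.Y) :
    S.phi r z.1 u.2 - S.phi r u.1 z.2
      ≤ (∫ o, pairDual d (m + 1) (S.G r dF z o) ∂S.law) (z - u) := by
  have hi := hLT.integrable_G hz
  rw [ContinuousLinearMap.integral_apply hi, Problem.phi, Problem.phi,
    ← integral_sub (S.integrable_Phi r hz.1 u.2) (S.integrable_Phi r hu.1 z.2)]
  refine integral_mono ((S.integrable_Phi r hz.1 u.2).sub (S.integrable_Phi r hu.1 z.2))
    (hi.apply_continuousLinearMap _) fun o => ?_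
  show S.Phi r z.1 u.2 o - S.Phi r u.1 z.2 o ≤ pairDual d (m + 1) (S.G r dF z o) (z - u)
  rw [pairDual_apply]
  simp only [Problem.G, Problem.Gx, Problem.Phi, Prod.fst_sub, Prod.snd_sub,
    neg_dotProduct, sum_dotProduct, smul_dotProduct, smul_eq_mul]
  -- For each sample: the subgradient inequality in `x`, with nonnegative weights; the `y` part is
  -- linear and therefore exact.
  have h1 : ∑ i, z.2 i * (S.F i z.1 (o i) - S.F i u.1 (o i))
      ≤ ∑ i, z.2 i * (dF i z.1 (o i) ⬝ᵥ (z.1 - u.1)) := by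
    refine Finset.sum_le_sum fun i _ => mul_le_mul_of_nonneg_left ?_ (hz.2.1 i)
    have h := hLT.subgradient i z.1 hz.1 (o i) u.1 hu.1
    rw [← neg_sub z.1 u.1, dotProduct_neg] at h
    linarith
  have h2 : ∑ i, u.2 i * (S.F i z.1 (o i) - S.levels r i)
      - ∑ i, z.2 i * (S.F i u.1 (o i) - S.levels r i)
      = ∑ i, z.2 i * (S.F i z.1 (o i) - S.F i u.1 (o i))
        - (fun i => S.F i z.1 (o i) - S.levels r i) ⬝ᵥ (z.2 - u.2) := by
    simp only [dotProduct, ← Finset.sum_sub_distrib]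
    refine Finset.sum_congr rfl fun i _ => ?_
    simp only [Pi.sub_apply]
    ring
  rw [h2, ← sub_eq_add_neg]
  exact sub_le_sub_right h1 _

end LightTailed

end Geometry

end SMD

/-! ## The iteration bound -/

namespace SMD

/-- Apply `log x ≤ x - 1` at `x = u / (2K)`: half of `u` pays for the tangent line, the other half
for `K log K`, and `log 2 < 1` covers the remainder. -/
theorem mul_log_le_of_two_mul_mul_log_le {K u : ℝ} (hK : 0 < K) (hu : 0 < u)
    (h : 2 * K * Real.log K ≤ u) : K * Real.log u ≤ u := by
  have h1 := Real.log_le_sub_one_of_pos (x := u / (2 * K)) (by positivity)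
  rw [Real.log_div hu.ne' (by positivity), Real.log_mul (by norm_num) hK.ne'] at h1
  have h2 : K * (u / (2 * K)) = u / 2 := by field_simp
  have h3 : Real.log 2 < 1 := by linarith [Real.log_two_lt_d9]
  nlinarith

theorem sum_one_div_add_one_le_log (n : ℕ) :
    ∑ s ∈ Finset.range n, 1 / ((s : ℝ) + 1) ≤ 1 + Real.log n := by
  have h := harmonic_le_one_add_log n
  rw [harmonic] at h
  push_cast at h
  simpa only [one_div] using h

theorem sqrt_le_sum_stepLength {M : ℝ} (hM : 0 < M) (t : ℕ) :
    √((t : ℝ) + 1) / M ≤ ∑ s ∈ Finset.range (t + 1), stepLength M s := by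
  have h : ∀ s ∈ Finset.range (t + 1), 1 / (M * √((t : ℝ) + 1)) ≤ stepLength M s := fun s hs => by
    have hs' : (s : ℝ) ≤ t := by exact_mod_cast Nat.lt_succ_iff.1 (Finset.mem_range.1 hs)
    unfold stepLength
    gcongr
  have h1 := Finset.card_nsmul_le_sum _ _ _ h
  rw [Finset.card_range, nsmul_eq_mul] at h1
  refine le_trans (le_of_eq ?_) h1
  have h2 : √((t : ℝ) + 1) * √((t : ℝ) + 1) = (t : ℝ) + 1 := Real.mul_self_sqrt (by positivity)
  have h3 : 0 < √((t : ℝ) + 1) := Real.sqrt_pos.2 (by positivity)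
  push_cast
  rw [mul_one_div, div_eq_div_iff hM.ne' (by positivity)]
  linear_combination M * h2

/-- For `t ≥ 6`, `log(t + 3) ≥ 2`, which absorbs additive constants. The branch `(4/3) ln(24/δ)` of
`Ω` controls the term linear in `L`, the branch `√(12 ln(24/δ))` the square root. -/
theorem regret_bound_le {δ : ℝ} (hδ₀ : 0 < δ) (hδ₁ : δ < 1) {t : ℕ} (ht : 6 ≤ t) :
    2 + 5 / 2 * ∑ s ∈ Finset.range (t + 1), 1 / ((s : ℝ) + 1) + 3 / 2 * Real.log (24 / δ)
        + 2 * √(32 * (∑ s ∈ Finset.range (t + 1), 1 / ((s : ℝ) + 1)) * Real.log (24 / δ))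
      ≤ Real.log ((t : ℝ) + 3) * (10 * OmegaConst δ + 4.5) := by
  set L := Real.log (24 / δ) with hLdef
  set l := Real.log ((t : ℝ) + 3) with hl
  set O := OmegaConst δ with hO
  set h := ∑ s ∈ Finset.range (t + 1), 1 / ((s : ℝ) + 1) with hh
  have ht' : (6 : ℝ) ≤ t := by exact_mod_cast ht
  have he := Real.exp_one_lt_d9
  have hL : 1 ≤ L := by
    rw [hLdef, Real.le_log_iff_exp_le (by positivity), le_div_iff₀ hδ₀]
    nlinarith [Real.exp_pos 1]
  have hl2 : 2 ≤ l := by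
    rw [hl, Real.le_log_iff_exp_le (by positivity)]
    have : Real.exp 2 = Real.exp 1 * Real.exp 1 := by rw [← Real.exp_add]; norm_num
    rw [this]
    nlinarith [Real.exp_pos 1]
  have hO1 : 4 / 3 * L ≤ O := le_max_right _ _
  have hO2 : 12 * L ≤ O ^ 2 := by
    have h1 : √(12 * L) ≤ O := le_max_left _ _
    calc 12 * L = √(12 * L) ^ 2 := (Real.sq_sqrt (by linarith)).symm
      _ ≤ O ^ 2 := by gcongr
  have hh1 : h ≤ 3 / 2 * l := by
    have h1 := sum_one_div_add_one_le_log (t + 1)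
    have h2 : Real.log ((t + 1 : ℕ) : ℝ) ≤ l := Real.log_le_log (by positivity) (by
      push_cast; linarith)
    linarith
  have hh0 : 0 ≤ h := Finset.sum_nonneg fun s _ => by positivity
  have hsqrt : √(32 * h * L) ≤ 3 / 2 * (l * O) := by
    rw [Real.sqrt_le_left (by nlinarith)]
    have h1 : 32 * h * L ≤ 32 * (3 / 2 * l) * L := by gcongr
    have h2 : 32 * (3 / 2 * l) * L = 4 * l * (12 * L) := by ring
    have h3 : 4 * l * (12 * L) ≤ 4 * l * O ^ 2 := by gcongr
    have h4 : 0 ≤ l * O ^ 2 := by positivity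
    nlinarith
  have hlO : 2 * O ≤ l * O := by
    have : 0 ≤ O := by linarith
    gcongr
  have hl43 : l * (4 / 3) ≤ l * O := by
    gcongr
    linarith
  linarith

theorem regret_div_le {M δ ε : ℝ} (hM : 0 < M) (hδ₀ : 0 < δ) (hδ₁ : δ < 1) (hε : 0 < ε) {t : ℕ}
    (ht : ⌊iterationBound M δ ε⌋₊ ≤ t) :
    2 + 5 / 2 * ∑ s ∈ Finset.range (t + 1), 1 / ((s : ℝ) + 1) + 3 / 2 * Real.log (24 / δ)
        + 2 * √(32 * (∑ s ∈ Finset.range (t + 1), 1 / ((s : ℝ) + 1)) * Real.log (24 / δ))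
      ≤ ε * ∑ s ∈ Finset.range (t + 1), stepLength M s := by
  have hWt : iterationBound M δ ε < (t : ℝ) + 1 :=
    (Nat.lt_floor_add_one _).trans_le (by exact_mod_cast Nat.succ_le_succ ht)
  have h6 : 6 ≤ t := (Nat.le_floor (by exact_mod_cast le_max_left _ _)).trans ht
  refine (regret_bound_le hδ₀ hδ₁ h6).trans ?_
  refine le_trans ?_ (mul_le_mul_of_nonneg_left (sqrt_le_sum_stepLength hM t) hε.le)
  set c := 10 * M * OmegaConst δ + 4.5 * M with hc
  set u := √((t : ℝ) + 3) with hu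
  have hO : 0 ≤ OmegaConst δ := (Real.sqrt_nonneg _).trans (le_max_left _ _)
  have hcpos : 0 < c := by rw [hc]; positivity
  have hu0 : 0 < u := Real.sqrt_pos.2 (by positivity)
  have hu2 : u ^ 2 = (t : ℝ) + 3 := Real.sq_sqrt (by positivity)
  -- The floor loses less than one, so the `-2` in `W` leaves the square below `t + 3 = u²`.
  have hW2 : (8 * c / ε * Real.log (4 * c / ε)) ^ 2 - 2 < (t : ℝ) + 1 :=
    (le_max_right _ _).trans_lt hWt
  -- The `4` is `2 · 2`: one factor from `log(t + 3) = 2 log u`, one from `√(t + 1) ≥ u/2`.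
  -- Comparing squares makes the sign of the logarithm irrelevant.
  have hQ : 2 * (4 * c / ε) * Real.log (4 * c / ε) ≤ u := by
    have h1 : 8 * c / ε * Real.log (4 * c / ε) ≤ u :=
      (abs_le_of_sq_le_sq' (by linarith) hu0.le).2
    calc _ = 8 * c / ε * Real.log (4 * c / ε) := by ring
      _ ≤ u := h1
  have key := mul_log_le_of_two_mul_mul_log_le (by positivity) hu0 hQ
  have hlog : Real.log ((t : ℝ) + 3) = 2 * Real.log u := by
    rw [← hu2, Real.log_pow]; norm_num
  have hhalf : u / 2 ≤ √((t : ℝ) + 1) := by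
    refine Real.le_sqrt_of_sq_le ?_
    rw [div_pow, hu2]
    linarith [(Nat.cast_nonneg t : (0 : ℝ) ≤ t)]
  have h1 : 4 * c * Real.log u ≤ ε * u := by
    rw [div_mul_eq_mul_div, div_le_iff₀ hε] at key
    linarith
  have h2 : Real.log ((t : ℝ) + 3) * (10 * OmegaConst δ + 4.5) = 2 * c * Real.log u / M := by
    rw [hlog, hc]; field_simp
  rw [h2, mul_div_assoc']
  refine div_le_div_of_nonneg_right ?_ hM.le
  linarith [mul_le_mul_of_nonneg_left hhalf hε.le]

/-! ## Saddle-point gap and the level-set function -/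

namespace Problem

variable {d m : ℕ} {Ξ : Fin (m + 1) → Type*} [∀ i, MeasurableSpace (Ξ i)] {S : Problem d Ξ}

theorem phi_le_P (S : Problem d Ξ) (r : ℝ) {x : Fin d → ℝ} (hx : x ∈ S.X)
    {y : Fin (m + 1) → ℝ} (hy : y ∈ S.Y) : S.phi r x y ≤ S.P r x := by
  rw [S.phi_eq r hx]
  calc ∑ i, y i * (S.f i x - S.levels r i) ≤ ∑ i, y i * S.P r x := by
        refine Finset.sum_le_sum fun i _ => mul_le_mul_of_nonneg_left ?_ (hy.1 i)
        exact Finset.le_sup' (fun i => S.f i x - S.levels r i) (Finset.mem_univ i)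
    _ = S.P r x := by rw [← Finset.sum_mul, hy.2, one_mul]

theorem exists_phi_eq_P (S : Problem d Ξ) (r : ℝ) {x : Fin d → ℝ} (hx : x ∈ S.X) :
    ∃ y ∈ S.Y, S.phi r x y = S.P r x := by
  obtain ⟨i, -, hi⟩ := Finset.exists_mem_eq_sup' Finset.univ_nonempty
    fun i : Fin (m + 1) => S.f i x - S.levels r i
  refine ⟨Pi.single i 1, single_mem_stdSimplex ℝ i, ?_⟩
  rw [S.phi_eq r hx, P, hi]
  simp [Pi.single_apply]

theorem U_eq_P (S : Problem d Ξ) (r : ℝ) {x : Fin d → ℝ} (hx : x ∈ S.X) :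
    S.U r x = S.P r x := by
  obtain ⟨y, hy, hyP⟩ := S.exists_phi_eq_P r hx
  refine IsGreatest.csSup_eq ⟨⟨y, hy, hyP⟩, ?_⟩
  rintro _ ⟨y', hy', rfl⟩
  exact S.phi_le_P r hx hy'

theorem U_sub_L_le (S : Problem d Ξ) {r ε : ℝ} {z : (Fin d → ℝ) × (Fin (m + 1) → ℝ)}
    (h : ∀ u ∈ S.X ×ˢ S.Y, S.phi r z.1 u.2 - S.phi r u.1 z.2 ≤ ε) :
    S.U r z.1 - S.L r z.2 ≤ ε := by
  rw [sub_le_iff_le_add]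
  refine csSup_le ((Geometry.nonempty_Y S).image _) ?_
  rintro _ ⟨y, hy, rfl⟩
  rw [← sub_le_iff_le_add']
  refine le_csInf (S.nonempty_X.image _) ?_
  rintro _ ⟨x, hx, rfl⟩
  have := h (x, y) ⟨hx, hy⟩
  show S.phi r z.1 y - ε ≤ S.phi r x z.2
  simp only at this
  linarith

/-- Weak duality: `φ(x, ȳ) ≤ 𝒫(r, x)` for every `x`, while some `y` attains `𝒫(r, x̄)`. The
resulting lower bound for `𝒫(r, ·)` also ensures that the infimum defining `H` is genuine. -/
theorem P_sub_H_mem (S : Problem d Ξ) {r ε : ℝ} {z : (Fin d → ℝ) × (Fin (m + 1) → ℝ)}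
    (hz : z ∈ S.X ×ˢ S.Y) (h : ∀ u ∈ S.X ×ˢ S.Y, S.phi r z.1 u.2 - S.phi r u.1 z.2 ≤ ε) :
    S.P r z.1 - S.H r ∈ Set.Icc 0 ε := by
  have hle : ∀ x ∈ S.X, S.P r z.1 - ε ≤ S.P r x := fun x hx => by
    obtain ⟨y, hy, hyP⟩ := S.exists_phi_eq_P r hz.1
    have h1 := h (x, y) ⟨hx, hy⟩
    have h2 := S.phi_le_P r hx hz.2
    simp only at h1
    linarith
  have hbdd : BddBelow (S.P r '' S.X) := ⟨S.P r z.1 - ε, by rintro _ ⟨x, hx, rfl⟩; exact hle x hx⟩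
  have h1 : S.H r ≤ S.P r z.1 := csInf_le hbdd ⟨z.1, hz.1, rfl⟩
  have h2 : S.P r z.1 - ε ≤ S.H r :=
    le_csInf (S.nonempty_X.image _) (by rintro _ ⟨x, hx, rfl⟩; exact hle x hx)
  exact ⟨by linarith, by linarith⟩

end Problem

/-! ## Convergence of stochastic mirror descent -/

namespace Geometry

variable {d m : ℕ} {Ξ : Fin (m + 1) → Type*} [∀ i, MeasurableSpace (Ξ i)] {S : Problem d Ξ}

theorem iterate_mem (B : Geometry S) (hDx : 0 < B.Dx) (hDy : 0 < B.Dy) (r : ℝ)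
    (dF : ∀ i, (Fin d → ℝ) → Ξ i → (Fin d → ℝ)) (γ : ℕ → ℝ) (ξ : ℕ → ∀ i, Ξ i) (t : ℕ) :
    B.iterate r dF γ ξ t ∈ S.X ×ˢ S.Y := by
  rw [iterate_eq_proxPoint]
  exact (B.isProxSetup hDx hDy).proxPoint_mem _

theorem average_eq_centerMass (B : Geometry S) (r : ℝ)
    (dF : ∀ i, (Fin d → ℝ) → Ξ i → (Fin d → ℝ)) (γ : ℕ → ℝ) (ξ : ℕ → ∀ i, Ξ i) (t : ℕ) :
    B.average r dF γ ξ t = (Finset.range (t + 1)).centerMass γ (B.iterate r dF γ ξ) := rfl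

theorem average_mem (B : Geometry S) (hDx : 0 < B.Dx) (hDy : 0 < B.Dy) (r : ℝ)
    (dF : ∀ i, (Fin d → ℝ) → Ξ i → (Fin d → ℝ)) {γ : ℕ → ℝ} (hγ : ∀ t, 0 < γ t)
    (ξ : ℕ → ∀ i, Ξ i) (t : ℕ) : B.average r dF γ ξ t ∈ S.X ×ˢ S.Y := by
  rw [average_eq_centerMass]
  exact (B.isProxSetup hDx hDy).convex.centerMass_mem (fun s _ => (hγ s).le)
    (Finset.sum_pos (fun s _ => hγ s) ⟨0, by simp⟩) fun s _ => B.iterate_mem hDx hDy r dF γ ξ s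

theorem stepLength_pos {M : ℝ} (hM : 0 < M) (t : ℕ) : 0 < stepLength M t := by
  have : 0 < √((t : ℝ) + 1) := Real.sqrt_pos.2 (by positivity)
  unfold stepLength
  positivity

theorem LightTailed.exists_event_gap_le {B : Geometry S} {r : ℝ}
    {dF : ∀ i, (Fin d → ℝ) → Ξ i → (Fin d → ℝ)} {Mx My : ℝ} (hLT : B.LightTailed r dF Mx My)
    (hDx : 0 < B.Dx) (hDy : 0 < B.Dy)
    {T : Type*} [MeasurableSpace T] (μ : Measure T) [IsProbabilityMeasure μ]
    (ξ : ℕ → T → ∀ i, Ξ i) (hξ : ∀ t, Measurable (ξ t)) (hindep : iIndepFun ξ μ)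
    (hlaw : ∀ t, μ.map (ξ t) = S.law) {ε δ : ℝ} (hε : 0 < ε) (hδ₀ : 0 < δ) (hδ₁ : δ < 1)
    {t : ℕ} (ht : ⌊iterationBound (B.M Mx My) δ ε⌋₊ ≤ t) :
    ∃ A : Set T, MeasurableSet A ∧ ENNReal.ofReal (1 - δ) ≤ μ A ∧
      ∀ τ ∈ A, ∀ u ∈ S.X ×ˢ S.Y,
        S.phi r (B.average r dF (stepLength (B.M Mx My)) (fun s => ξ s τ) t).1 u.2
          - S.phi r u.1 (B.average r dF (stepLength (B.M Mx My)) (fun s => ξ s τ) t).2 ≤ ε := by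
  have := S.isProbabilityMeasure_law
  have hM := hLT.M_pos hDx
  set M := B.M Mx My with hMdef
  have hP := B.isProxSetup hDx hDy
  set γ := stepLength M with hγ
  have hL : 0 < Real.log (24 / δ) := Real.log_pos (by rw [lt_div_iff₀ hδ₀]; linarith)
  have hGm : Measurable fun p : (((Fin d → ℝ) × (Fin (m + 1) → ℝ)) →L[ℝ] ℝ) × (∀ i, Ξ i) =>
      pairDual d (m + 1) (S.G r dF (proxPoint (S.X ×ˢ S.Y) B.ωz p.1) p.2) :=
    (pairDual d (m + 1)).continuous.measurable.comp
      (hLT.measurable_G (hP.continuous_proxPoint.measurable.comp measurable_fst)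
        (fun p => hP.proxPoint_mem p.1) measurable_snd)
  obtain ⟨A, hA, hμA, hreg⟩ := hP.exists_event_regret_le
    (fun u hu v hv => B.ωz_sub_le_one hDx hDy hu hv) hξ hindep hlaw
    (Gs := fun z o => pairDual d (m + 1) (S.G r dF z o)) hGm
    (fun z hz => hLT.integrable_G hz) hM (fun z hz => hLT.exp_moment_G hDx hz)
    (fun z hz => hLT.sqDualNorm_integral_le hz)
    (η := fun t τ => B.dualIterate r dF γ (fun s => ξ s τ) t) (fun τ => rfl)
    (fun t τ => by
      rw [← iterate_eq_proxPoint]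
      rfl) hL t.succ_pos
  refine ⟨A, hA, le_trans (ENNReal.ofReal_le_ofReal ?_) hμA, fun τ hτ u hu => ?_⟩
  -- With `L = ln(24/δ)` the two bad events have total probability at most `2 · δ/24 ≤ δ`.
  · rw [Real.exp_neg, Real.exp_log (by positivity), inv_div]
    linarith
  have h1 := (hreg τ hτ u hu).trans (regret_div_le hM hδ₀ hδ₁ hε ht)
  simp only [← iterate_eq_proxPoint] at h1
  have hΓ : 0 < ∑ s ∈ Finset.range (t + 1), γ s :=
    Finset.sum_pos (fun s _ => stepLength_pos hM s) ⟨0, by simp⟩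
  have h2 := (S.convexOn_gap r hu).map_centerMass_le (t := Finset.range (t + 1)) (w := γ)
    (p := B.iterate r dF γ fun s => ξ s τ) (fun s _ => (stepLength_pos hM s).le) hΓ
    (fun s _ => B.iterate_mem hDx hDy r dF γ _ s)
  rw [← average_eq_centerMass] at h2
  refine h2.trans ?_
  rw [Finset.centerMass, smul_eq_mul, inv_mul_le_iff₀ hΓ, mul_comm _ ε]
  refine le_trans (Finset.sum_le_sum fun s _ => ?_) h1
  rw [Function.comp_apply, smul_eq_mul]
  exact mul_le_mul_of_nonneg_left (hLT.gap_le (B.iterate_mem hDx hDy r dF γ _ s) hu)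
    (stepLength_pos hM s).le

end Geometry

end SMD

theorem proposition1 {d m : ℕ} (hm : 1 ≤ m) {Ξ : Fin (m + 1) → Type*}
    [∀ i, MeasurableSpace (Ξ i)] (S : SMD.Problem d Ξ) (hS : S.StrictlyFeasible)
    (B : SMD.Geometry S) (r : ℝ) (hr : S.fstar < r)
    (dF : ∀ i, (Fin d → ℝ) → Ξ i → (Fin d → ℝ)) (Mx My : ℝ) (hLT : B.LightTailed r dF Mx My)
    {T : Type*} [MeasurableSpace T] (μ : Measure T) [IsProbabilityMeasure μ]
    (ξ : ℕ → T → ∀ i, Ξ i) (hξ : ∀ t, Measurable (ξ t)) (hindep : iIndepFun ξ μ)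
    (hlaw : ∀ t, μ.map (ξ t) = S.law)
    (ε δ : ℝ) (hε : 0 < ε) (hδ₀ : 0 < δ) (hδ₁ : δ < 1)
    (γ : ℕ → ℝ) (hγ : γ = SMD.stepLength (B.M Mx My)) :
    (∀ t : ℕ, ⌊SMD.iterationBound (B.M Mx My) δ ε⌋₊ ≤ t →
      SMD.HoldsWithProbAtLeast μ (1 - δ) fun τ =>
        S.U r (B.average r dF γ (fun s => ξ s τ) t).1
          - S.L r (B.average r dF γ (fun s => ξ s τ) t).2 ≤ ε) ∧
    (∀ N : ℕ, SMD.iterationBound (B.M Mx My) δ ε ≤ N →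
      S.IsStochasticOracle r ε δ μ fun τ => B.output r dF γ N fun s => ξ s τ) := by
  have hDx := B.Dx_pos hS
  have hDy := B.Dy_pos hm
  have hM := hLT.M_pos hDx
  subst hγ
  refine ⟨fun t ht => ?_, fun N hN => ⟨fun τ => ?_, ?_⟩⟩
  · obtain ⟨A, hA, hμ, h⟩ :=
      hLT.exists_event_gap_le hDx hDy μ ξ hξ hindep hlaw hε hδ₀ hδ₁ ht
    exact ⟨A, hA, fun τ hτ => S.U_sub_L_le (h τ hτ), hμ⟩
  · exact (B.average_mem hDx hDy r dF (SMD.Geometry.stepLength_pos hM) _ N).1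
  · obtain ⟨A, hA, hμ, h⟩ := hLT.exists_event_gap_le hDx hDy μ ξ hξ hindep hlaw hε hδ₀ hδ₁
      (Nat.floor_le_of_le hN)
    refine ⟨A, hA, fun τ hτ => ?_, hμ⟩
    have hmem := B.average_mem hDx hDy r dF (SMD.Geometry.stepLength_pos hM) (fun s => ξ s τ) N
    have hPH := S.P_sub_H_mem hmem (h τ hτ)
    simp only [SMD.Geometry.output]
    -- The returned value equals `𝒫(r, x̂)`, so both oracle inequalities are one and the same.
    rw [S.U_eq_P r hmem.1, abs_of_nonneg hPH.1]
    exact ⟨hPH.2, hPH.2⟩
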